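/- Throughout, manifolds are connected, Hausdorff, second countable, without boundary, and all objects are smooth. Let $M$ be an oriented manifold of dimension $n\ge 2$. For $v\in S^2(T^*M)\otimes TM$ put $v_0=v-\frac{1}{n+1}\iota(\operatorname{tr}v)$, where $\iota(\nu)=\nu\otimes\mathrm{Id}+\mathrm{Id}\otimes\nu$ for a $1$-form $\nu$, and $(\operatorname{tr}v)_j=v^i_{ij}$. A projective structure $\mathfrak p$ on $M$ is an equivalence class of torsion-free connections on $TM$, two connections being equivalent if they have the same unparametrised geodesics. A conformal structure $[g]$ is an equivalence class of Riemannian metrics, with $\hat g\sim g$ if $\hat g=e^{2f}g$ for some $f\in C^\infty(M)$. A torsion-free connection $\nabla$ is $[g]$-conformal if $\nabla g=2\beta\otimes g$ for some $1$-form $\beta$. Given $\mathfrak p$ and $[g]$, choose $\nabla\in\mathfrak p$ and $g\in[g]$, let ${}^g\nabla$ be the Levi-Civita connection of $g$, and set $$X_g=\frac{n+1}{(n+2)(n-1)}\operatorname{tr}\bigl(g^\sharp\otimes(\nabla-{}^g\nabla)_0\bigr),\qquad A_{[g]}=\bigl(\nabla-{}^g\nabla-g\otimes X_g\bigr)_0,$$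 $$\mathcal E_{\mathfrak p}([g])=\int_M|A_{[g]}|_g^n\,d\mu_g\in[0,\infty],\qquad \Gamma\delta(M,\mathfrak p)=\inf_{[g]}\mathcal E_{\mathfrak p}([g]);$$ here $A_{[g]}$ and $|A_{[g]}|^n_g\,d\mu_g$ depend only on $\mathfrak p$ and $[g]$. Finally let $$\mathrm{Aff}(M,\nabla)=\{\Phi\in\mathrm{Diff}(M):\Phi^*\nabla=\nabla\},\qquad \mathrm{Conf}(M,[g])=\{\Phi\in\mathrm{Diff}(M):\Phi^*g\in[g]\},$$ $$\mathrm{Proj}(M,\mathfrak p)=\{\Phi\in\mathrm{Diff}(M):(\Phi^*\nabla-\nabla)_0=0\text{ for }\nabla\in\mathfrak p\}.$$ **Theorem.** Suppose that the infimum $\Gamma\delta(M,\mathfrak p)$ is attained on a unique conformal structure $[g]$. Then, with ${}^{[g]}\nabla$ the unique $[g]$-conformal connection such that ${}^{[g]}\nabla+A_{[g]}\in\mathfrak p$ (which exists), $$\mathrm{Proj}(M,\mathfrak p)=\mathrm{Aff}\bigl(M,{}^{[g]}\nabla+A_{[g]}\bigr)\subset\mathrm{Conf}(M,[g]).$$ 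-/

import Mathlib

open scoped Manifold ContDiff Bundle ENNReal

namespace ProjConf

section PointwiseAlgebra

variable {V : Type*} [AddCommGroup V] [Module ℝ V] [TopologicalSpace V] [IsTopologicalAddGroup V]
  [ContinuousSMul ℝ V] [FiniteDimensional ℝ V] [T2Space V]

/-- The trace `V* ⊗ V* ⊗ V → V*`; in a basis `(tr v)_j = v^i_{ij}`. -/
noncomputable def tr (v : V →L[ℝ] V →L[ℝ] V) : V →L[ℝ] ℝ :=
  LinearMap.toContinuousLinearMap
    ((LinearMap.trace ℝ V) ∘ₗ (ContinuousLinearMap.toLinearMap₁₂ v).flip)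

/-- The inclusion `ι(ν) = ν ⊗ Id + Id ⊗ ν`. -/
noncomputable def iota (ν : V →L[ℝ] ℝ) : V →L[ℝ] V →L[ℝ] V :=
  (LinearMap.mk₂ ℝ (fun X Y : V => ν X • Y + ν Y • X)
    (fun X X' Y => by simp only [map_add]; module) (fun c X Y => by simp only [map_smul]; module)
    (fun X Y Y' => by simp only [map_add]; module)
    (fun c X Y => by simp only [map_smul]; module)).toContinuousBilinearMap

/-- The trace-free part `v₀ = v - (n + 1)⁻¹ ι(tr v)`, where `n = dim V`. -/
noncomputable def traceFree (v : V →L[ℝ] V →L[ℝ] V) : V →L[ℝ] V →L[ℝ] V :=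
  v - ((Module.finrank ℝ V : ℝ) + 1)⁻¹ • iota (tr v)

/-- The element `B ⊗ Z` of `V* ⊗ V* ⊗ V`, that is, `(X, Y) ↦ B(X, Y) Z`. -/
noncomputable def tensorVec (B : V →L[ℝ] V →L[ℝ] ℝ) (Z : V) : V →L[ℝ] V →L[ℝ] V :=
  (LinearMap.mk₂ ℝ (fun X Y : V => B X Y • Z)
    (fun X X' Y => by simp only [map_add, _root_.add_apply]; module)
    (fun c X Y => by
      simp only [map_smul, _root_.smul_apply, smul_eq_mul]; module)
    (fun X Y Y' => by simp only [map_add]; module)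
    (fun c X Y => by simp only [map_smul, smul_eq_mul]; module)).toContinuousBilinearMap

variable {ι : Type*} [Fintype ι] [DecidableEq ι]

/-- The Gram matrix `(B_{ij})` of a bilinear form in a basis. -/
noncomputable def gram (b : Module.Basis ι ℝ V) (B : V →L[ℝ] V →L[ℝ] ℝ) : Matrix ι ι ℝ :=
  Matrix.of fun i j => B (b i) (b j)

/-- The contraction `tr(B^♯ ⊗ v) = B^{ij} v_{ij}` of `v` with the dual of the scalar product `B`
(independent of the basis). -/
noncomputable def contract (b : Module.Basis ι ℝ V) (B : V →L[ℝ] V →L[ℝ] ℝ)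
    (v : V →L[ℝ] V →L[ℝ] V) : V :=
  ∑ i, ∑ j, (gram b B)⁻¹ i j • v (b i) (b j)

/-- The norm `|v|_B` on `V* ⊗ V* ⊗ V` induced by the scalar product `B`, with
`|v|²_B = B^{ik} B^{jl} B(v_{ij}, v_{kl})` (independent of the basis). -/
noncomputable def tensorNorm (b : Module.Basis ι ℝ V) (B : V →L[ℝ] V →L[ℝ] ℝ)
    (v : V →L[ℝ] V →L[ℝ] V) : ℝ :=
  Real.sqrt (∑ i, ∑ j, ∑ k, ∑ l,
    (gram b B)⁻¹ i k * (gram b B)⁻¹ j l * B (v (b i) (b j)) (v (b k) (b l)))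

/-- The algebraic core of the fundamental theorem of Riemannian geometry. -/
theorem exists_koszul (B : V →L[ℝ] V →L[ℝ] ℝ) (hs : ∀ u v, B u v = B v u)
    (hp : ∀ v, v ≠ 0 → 0 < B v v) (Q : V → V → V → ℝ)
    (hQ : ∀ u w v, Q u w v = Q w u v)
    (ha₁ : ∀ u u' w v, Q (u + u') w v = Q u w v + Q u' w v)
    (hm₁ : ∀ (c : ℝ) u w v, Q (c • u) w v = c * Q u w v)
    (ha₃ : ∀ u w v v', Q u w (v + v') = Q u w v + Q u w v')
    (hm₃ : ∀ (c : ℝ) u w v, Q u w (c • v) = c * Q u w v) :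
    ∃ K : V →L[ℝ] V →L[ℝ] V, (∀ u v, K u v = K v u) ∧
      ∀ u w v, B (K u v) w + B u (K w v) = Q u w v := by
  let B' : LinearMap.BilinForm ℝ V := ContinuousLinearMap.toLinearMap₁₂ B
  have hB : B'.Nondegenerate := by
    have hr : B'.IsRefl := fun u v huv => (hs v u).trans huv
    refine hr.nondegenerate_iff_separatingLeft.mpr fun u hu => ?_
    by_contra hne
    exact (hp u hne).ne' (hu u)
  let L (u v : V) : Module.Dual ℝ V :=
    { toFun := fun w => 2⁻¹ * (Q u w v + Q v w u - Q u v w)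
      map_add' := fun w w' => by rw [hQ u, hQ v, ha₁, ha₁, ha₃, hQ w, hQ w', hQ w v, hQ w' v]; ring
      map_smul' := fun c w => by
        rw [hQ u, hQ v, hm₁, hm₁, hm₃, hQ w, hQ w, smul_eq_mul, RingHom.id_apply]; ring }
  have hL (u v w : V) : L u v w = 2⁻¹ * (Q u w v + Q v w u - Q u v w) := rfl
  have h1 (u u' v : V) : L (u + u') v = L u v + L u' v := by
    ext w; rw [LinearMap.add_apply, hL, hL, hL, ha₁, ha₁, ha₃]; ring
  have h2 (c : ℝ) (u v : V) : L (c • u) v = c • L u v := by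
    ext w; rw [LinearMap.smul_apply, hL, hL, hm₁, hm₁, hm₃, smul_eq_mul]; ring
  have h3 (u v : V) : L u v = L v u := by
    ext w; rw [hL, hL, hQ u v w]; ring
  let K : V →L[ℝ] V →L[ℝ] V :=
    (LinearMap.mk₂ ℝ (fun u v => (B'.toDual hB).symm (L u v))
      (fun u u' v => by rw [← map_add, h1]) (fun c u v => by rw [← map_smul, h2])
      (fun u v v' => by rw [← map_add, h3, h1, h3 v, h3 v'])
      (fun c u v => by rw [← map_smul, h3, h2, h3 v])).toContinuousBilinearMap
  have hK (u v w : V) : B (K u v) w = 2⁻¹ * (Q u w v + Q v w u - Q u v w) :=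
    LinearMap.BilinForm.apply_toDual_symm_apply (hB := hB) (L u v) w
  refine ⟨K, fun u v => congrArg _ (h3 u v), fun u w v => ?_⟩
  rw [hs u, hK, hK, hQ w u v, hQ w v u, hQ u v w]
  ring

end PointwiseAlgebra

section Manifold

set_option linter.unusedSectionVars false

variable (n : ℕ) (M : Type*) [TopologicalSpace M] [ChartedSpace (EuclideanSpace ℝ (Fin n)) M]
  [IsManifold (𝓡 n) ∞ M]

/-- Connections (covariant derivatives) on the tangent bundle `TM`. In Mathlib's convention
`D Y x v` is `(∇_v Y)(x)`. -/
abbrev Connection : Type _ :=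
  CovariantDerivative (𝓡 n) (EuclideanSpace ℝ (Fin n)) (TangentSpace (𝓡 n) : M → Type _)

/-- Smooth Riemannian metrics on `M`. -/
abbrev Metric : Type _ :=
  Bundle.ContMDiffRiemannianMetric (𝓡 n) ∞ (EuclideanSpace ℝ (Fin n))
    (TangentSpace (𝓡 n) : M → Type _)

variable {n M}

instance instFiniteDimensionalTangent (x : M) : FiniteDimensional ℝ (TangentSpace (𝓡 n) x) :=
  inferInstanceAs (FiniteDimensional ℝ (EuclideanSpace ℝ (Fin n)))

instance instT2SpaceTangent (x : M) : T2Space (TangentSpace (𝓡 n) x) :=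
  inferInstanceAs (T2Space (EuclideanSpace ℝ (Fin n)))

/-- The standard basis of `T_x M = ℝⁿ`. -/
noncomputable def tangentBasis (x : M) : Module.Basis (Fin n) ℝ (TangentSpace (𝓡 n) x) :=
  (EuclideanSpace.basisFun (Fin n) ℝ).toBasis

/-! ### Connections -/

/-- Smooth torsion-free connections on `TM`. -/
def IsTorsionFree (D : Connection n M) : Prop :=
  D.torsion = 0 ∧ D.ContMDiffCovariantDerivative ∞

/-- Two covariant derivatives define the same connection if the difference tensor vanishes, that
is, if they agree on differentiable vector fields. (Mathlib's covariant derivatives carry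
irrelevant values on vector fields that are not differentiable.) -/
def SameConnection (D D' : Connection n M) : Prop :=
  ∀ x, D.difference D' x = 0

theorem isInvertible_mfderiv (Φ : M ≃ₘ^∞⟮𝓡 n, 𝓡 n⟯ M) (x : M) :
    (mfderiv (𝓡 n) (𝓡 n) Φ x).IsInvertible :=
  ⟨Φ.mfderivToContinuousLinearEquiv (by simp) x, rfl⟩

/-- The push-forward `Φ_* Y` of a vector field under a diffeomorphism. -/
noncomputable def pushforward (Φ : M ≃ₘ^∞⟮𝓡 n, 𝓡 n⟯ M) (Y : Π x : M, TangentSpace (𝓡 n) x) :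
    Π x : M, TangentSpace (𝓡 n) x :=
  VectorField.mpullback (𝓡 n) (𝓡 n) Φ.symm Y

theorem pushforward_apply (Φ : M ≃ₘ^∞⟮𝓡 n, 𝓡 n⟯ M) (Y : Π x : M, TangentSpace (𝓡 n) x) (x : M) :
    pushforward Φ Y (Φ x) = mfderiv (𝓡 n) (𝓡 n) Φ x (Y x) := by
  have h1 : (mfderiv (𝓡 n) (𝓡 n) Φ.symm (Φ x)).IsInvertible :=
    isInvertible_mfderiv Φ.symm (Φ x)
  have hY : (Y (Φ.symm (Φ x)) : EuclideanSpace ℝ (Fin n)) = Y x := by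
    rw [Φ.symm_apply_apply]
  have hc : ∀ v : EuclideanSpace ℝ (Fin n),
      mfderiv (𝓡 n) (𝓡 n) Φ.symm (Φ x) (mfderiv (𝓡 n) (𝓡 n) Φ x v) = v := by
    intro v
    have h2 := mfderiv_comp x (Φ.symm.mdifferentiable (by simp) (Φ x))
      (Φ.mdifferentiable (by simp) x)
    have h3 : (Φ.symm ∘ Φ : M → M) = id := by ext y; simp
    rw [h3, mfderiv_id] at h2
    exact (congrArg (fun L => L v) h2).symm
  obtain ⟨e, he⟩ := h1
  unfold pushforward
  rw [VectorField.mpullback_apply, ← he, ContinuousLinearMap.inverse_equiv]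
  have h4 := hc (Y x)
  rw [← he] at h4
  refine e.injective ?_
  refine (e.apply_symm_apply _).trans ?_
  exact hY.trans h4.symm

theorem mdifferentiableAt_pushforward (Φ : M ≃ₘ^∞⟮𝓡 n, 𝓡 n⟯ M)
    {Y : Π x : M, TangentSpace (𝓡 n) x} {x : M}
    (hY : MDifferentiableAt (𝓡 n) (𝓡 n).tangent
      (fun x => (⟨x, Y x⟩ : TangentBundle (𝓡 n) M)) x) :
    MDifferentiableAt (𝓡 n) (𝓡 n).tangent
      (fun x => (⟨x, pushforward Φ Y x⟩ : TangentBundle (𝓡 n) M)) (Φ x) := by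
  refine MDifferentiableAt.mpullback_vectorField (n := ∞) ?_ (Φ.symm.contMDiff (Φ x))
    (isInvertible_mfderiv Φ.symm (Φ x)) (by norm_cast)
  rw [Φ.symm_apply_apply]
  exact hY

/-- The pull-back connection `(Φ^*∇)_v Y = (dΦ)⁻¹ (∇_{dΦ(v)} (Φ_* Y))`. -/
noncomputable def pullback (Φ : M ≃ₘ^∞⟮𝓡 n, 𝓡 n⟯ M) (D : Connection n M) : Connection n M where
  toFun Y x := (mfderiv (𝓡 n) (𝓡 n) Φ x).inverse ∘L
    (D (pushforward Φ Y) (Φ x)) ∘L (mfderiv (𝓡 n) (𝓡 n) Φ x)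
  isCovariantDerivativeOnUniv := by
    constructor
    · intro σ σ' x hσ hσ' _
      have h : pushforward Φ (σ + σ') = pushforward Φ σ + pushforward Φ σ' :=
        VectorField.mpullback_add
      rw [h, D.isCovariantDerivativeOnUniv.add (mdifferentiableAt_pushforward Φ hσ)
        (mdifferentiableAt_pushforward Φ hσ')]
      ext v
      simp
    · intro σ f x hσ hf _
      have h : pushforward Φ (f • σ) = (f ∘ Φ.symm) • pushforward Φ σ :=
        VectorField.mpullback_smul
      have hf' : MDifferentiableAt (𝓡 n) 𝓘(ℝ, ℝ) f (Φ.symm (Φ x)) := by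
        rw [Φ.symm_apply_apply]; exact hf
      have hg : MDifferentiableAt (𝓡 n) 𝓘(ℝ, ℝ) (f ∘ Φ.symm) (Φ x) :=
        hf'.comp _ (Φ.symm.mdifferentiable (by simp) (Φ x))
      have hd : ∀ v : TangentSpace (𝓡 n) x,
          mvfderiv (𝓡 n) (f ∘ Φ.symm) (Φ x) (mfderiv (𝓡 n) (𝓡 n) Φ x v)
            = mvfderiv (𝓡 n) f x v := by
        intro v
        have h2 := mfderiv_comp x hg (Φ.mdifferentiable (by simp) x)
        have h3 : ((f ∘ Φ.symm) ∘ Φ : M → ℝ) = f := by ext y; simp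
        rw [h3] at h2
        have h4 : mfderiv (𝓡 n) 𝓘(ℝ, ℝ) f x v = mfderiv (𝓡 n) 𝓘(ℝ, ℝ) (f ∘ Φ.symm) (Φ x)
          (mfderiv (𝓡 n) (𝓡 n) Φ x v) := congrArg (fun L => L v) h2
        exact h4.symm
      rw [h, D.isCovariantDerivativeOnUniv.leibniz (mdifferentiableAt_pushforward Φ hσ) hg]
      ext v
      have h5 : (mfderiv (𝓡 n) (𝓡 n) Φ x).inverse (mfderiv (𝓡 n) (𝓡 n) Φ x (σ x)) = σ x :=
        (isInvertible_mfderiv Φ x).inverse_apply_eq.mpr rfl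
      simp [hd, pushforward_apply, h5]

/-! ### Projective structures -/

/-- The velocity `γ'(t)` of a curve in `M`. -/
noncomputable def velocity (γ : ℝ → M) (t : ℝ) : TangentSpace (𝓡 n) (γ t) :=
  mfderiv 𝓘(ℝ, ℝ) (𝓡 n) γ t (1 : ℝ)

/-- `γ : (a, b) → M` is an unparametrised geodesic of `D`: a smooth immersed curve such that
`∇_{γ'} γ'` is everywhere a multiple of `γ'`, i.e. a geodesic up to reparametrisation. Here
`∇_{γ'} γ'` at time `t` is computed by means of an arbitrary extension of `γ'` near time `t` to a
smooth vector field on `M`. -/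
structure IsUnparametrisedGeodesic (D : Connection n M) (γ : ℝ → M) (a b : ℝ) : Prop where
  smooth : ContMDiffOn 𝓘(ℝ, ℝ) (𝓡 n) ∞ γ (Set.Ioo a b)
  immersed : ∀ t ∈ Set.Ioo a b, velocity (n := n) γ t ≠ 0
  geodesic : ∀ t ∈ Set.Ioo a b, ∀ X : Π x : M, TangentSpace (𝓡 n) x,
    ContMDiff (𝓡 n) (𝓡 n).tangent ∞
      (fun x => (⟨x, X x⟩ : TangentBundle (𝓡 n) M)) →
    (∀ᶠ s in nhds t, X (γ s) = velocity (n := n) γ s) →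
    ∃ c : ℝ, D X (γ t) (velocity (n := n) γ t) = c • velocity (n := n) γ t

variable (n M) in
/-- The space of smooth torsion-free connections on `TM`. -/
abbrev TorsionFreeConnection : Type _ := {D : Connection n M // IsTorsionFree D}

variable (n M) in
/-- Projective equivalence: the two connections share the same unparametrised geodesics. -/
def projectiveSetoid : Setoid (TorsionFreeConnection n M) where
  r D D' := ∀ (γ : ℝ → M) (a b : ℝ),
    IsUnparametrisedGeodesic D.1 γ a b ↔ IsUnparametrisedGeodesic D'.1 γ a b
  iseqv := ⟨fun _ _ _ _ => Iff.rfl, fun h γ a b => (h γ a b).symm,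
    fun h h' γ a b => (h γ a b).trans (h' γ a b)⟩

variable (n M) in
/-- A projective structure is a projective equivalence class of torsion-free connections. -/
def ProjectiveStructure : Type _ := Quotient (projectiveSetoid n M)

/-- `∇ ∈ 𝔭`, i.e. `∇` is a (torsion-free) representative of the projective structure `𝔭`. -/
def Represents (D : Connection n M) (p : ProjectiveStructure n M) : Prop :=
  ∃ h : IsTorsionFree D, Quotient.mk (projectiveSetoid n M) ⟨D, h⟩ = p

/-! ### Riemannian metrics and conformal structures -/

/-- Two metrics are conformally equivalent, `[g] = [g']`, if `g' = e^{2f} g` for a smooth `f`. -/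
def ConformallyEquivalent (g g' : Metric n M) : Prop :=
  ∃ f : M → ℝ, ContMDiff (𝓡 n) 𝓘(ℝ, ℝ) ∞ f ∧
    ∀ x v w, g'.inner x v w = Real.exp (2 * f x) * g.inner x v w

/-- The covariant derivative `∇g` of a metric: `nablaMetric g D x u w v = (∇_v g)(u, w)`. -/
noncomputable def nablaMetric (g : Metric n M) (D : Connection n M) (x : M) :
    TangentSpace (𝓡 n) x →L[ℝ] TangentSpace (𝓡 n) x →L[ℝ] TangentSpace (𝓡 n) x →L[ℝ] ℝ :=
  letI : Bundle.RiemannianBundle (TangentSpace (𝓡 n) : M → Type _) := ⟨g.toRiemannianMetric⟩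
  D.derivMetricTensor x

theorem nablaMetric_apply (g : Metric n M) (D : Connection n M) {x : M}
    {Y Z : Π x : M, TangentSpace (𝓡 n) x}
    (hY : MDifferentiableAt (𝓡 n) (𝓡 n).tangent
      (fun x => (⟨x, Y x⟩ : TangentBundle (𝓡 n) M)) x)
    (hZ : MDifferentiableAt (𝓡 n) (𝓡 n).tangent
      (fun x => (⟨x, Z x⟩ : TangentBundle (𝓡 n) M)) x) (v : TangentSpace (𝓡 n) x) :
    nablaMetric g D x (Y x) (Z x) v =
      mvfderiv (𝓡 n) (fun y => g.inner y (Y y) (Z y)) x v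
        - g.inner x (D Y x v) (Z x) - g.inner x (Y x) (D Z x v) := by
  let _ : Bundle.RiemannianBundle (TangentSpace (𝓡 n) : M → Type _) := ⟨g.toRiemannianMetric⟩
  have h := CovariantDerivative.derivMetricTensor_apply D x hY hZ
    (X := FiberBundle.extend (EuclideanSpace ℝ (Fin n)) v)
  beta_reduce at h
  rw [FiberBundle.extend_apply_self] at h
  exact h

theorem nablaMetric_symm (g : Metric n M) (D : Connection n M) (x : M)
    (u w v : TangentSpace (𝓡 n) x) : nablaMetric g D x u w v = nablaMetric g D x w u v := by
  have hu := FiberBundle.mdifferentiableAt_extend (𝓡 n) (EuclideanSpace ℝ (Fin n)) u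
  have hw := FiberBundle.mdifferentiableAt_extend (𝓡 n) (EuclideanSpace ℝ (Fin n)) w
  have h1 := nablaMetric_apply g D hu hw v
  have h2 := nablaMetric_apply g D hw hu v
  rw [FiberBundle.extend_apply_self, FiberBundle.extend_apply_self] at h1 h2
  rw [h1, h2, g.symm x _ w, g.symm x u]
  simp only [g.symm _ (FiberBundle.extend (EuclideanSpace ℝ (Fin n)) u _)]
  ring

/-- `D` is a Levi-Civita connection of `g`: it is torsion-free and `∇g = 0`. -/
def IsLeviCivita (g : Metric n M) (D : Connection n M) : Prop :=
  D.torsion = 0 ∧ ∀ x, nablaMetric g D x = 0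

theorem exists_isLeviCivita (g : Metric n M) (h : Nonempty (TorsionFreeConnection n M)) :
    ∃ D : Connection n M, IsLeviCivita g D := by
  obtain ⟨D₀, hD₀⟩ := h
  choose K hKs hK using fun x : M => exists_koszul (g.inner x) (g.symm x) (g.pos x)
    (fun u w v => nablaMetric g D₀ x u w v) (nablaMetric_symm g D₀ x)
    (fun u u' w v => congrArg (fun T => T w v) ((nablaMetric g D₀ x).map_add u u'))
    (fun c u w v => congrArg (fun T => T w v) ((nablaMetric g D₀ x).map_smul c u))
    (fun u w v v' => (nablaMetric g D₀ x u w).map_add v v')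
    (fun c u w v => (nablaMetric g D₀ x u w).map_smul c v)
  refine ⟨D₀.addOneForm K, ?_, fun x => ?_⟩
  · rw [CovariantDerivative.torsion_eq_zero_iff]
    intro X Y x hX hY
    rw [← D₀.torsion_eq_zero_iff.mp hD₀.1 hX hY]
    change (D₀ Y x (X x) + K x (Y x) (X x)) - (D₀ X x (Y x) + K x (X x) (Y x)) = _
    rw [hKs]; abel
  · ext u w v
    have hu := FiberBundle.mdifferentiableAt_extend (𝓡 n) (EuclideanSpace ℝ (Fin n)) u
    have hw := FiberBundle.mdifferentiableAt_extend (𝓡 n) (EuclideanSpace ℝ (Fin n)) w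
    have h1 := nablaMetric_apply g (D₀.addOneForm K) hu hw v
    have h2 := nablaMetric_apply g D₀ hu hw v
    rw [FiberBundle.extend_apply_self, FiberBundle.extend_apply_self] at h1 h2
    have e1 : ∀ Y : Π x : M, TangentSpace (𝓡 n) x,
      (D₀.addOneForm K) Y x v = D₀ Y x v + K x (Y x) v := fun _ => rfl
    rw [e1, e1, FiberBundle.extend_apply_self, FiberBundle.extend_apply_self, map_add, map_add,
      _root_.add_apply] at h1
    have h3 := hK x u w v
    rw [h1]
    change _ = (0 : ℝ)
    linarith

/-- The Levi-Civita connection `ᵍ∇` of `g`. (It is unique in the sense of `SameConnection`; the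
argument `h`, that `M` carries some torsion-free connection, only serves to prove existence.) -/
noncomputable def leviCivita (g : Metric n M) (h : Nonempty (TorsionFreeConnection n M)) :
    Connection n M :=
  (exists_isLeviCivita g h).choose

/-- `D` is a `[g]`-conformal (Weyl) connection: it is smooth and torsion-free and
`∇g = 2 β ⊗ g` for a `1`-form `β` (which is then automatically smooth). -/
def IsConformalConnection (g : Metric n M) (D : Connection n M) : Prop :=
  IsTorsionFree D ∧ ∃ β : Π x : M, TangentSpace (𝓡 n) x →L[ℝ] ℝ,
    ∀ x u w v, nablaMetric g D x u w v = 2 * β x v * g.inner x u w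

/-! ### The tensor `A_{[g]}` and the functional `𝓔_𝔭` -/

/-- A representative `∇ ∈ 𝔭`. Nothing below depends on which one is chosen. -/
noncomputable def ProjectiveStructure.rep (p : ProjectiveStructure n M) :
    TorsionFreeConnection n M :=
  @Quotient.out _ (projectiveSetoid n M) p

/-- The tensor field `∇ - ᵍ∇`, where `∇ ∈ 𝔭`. -/
noncomputable def differenceLC (p : ProjectiveStructure n M) (g : Metric n M) (x : M) :
    TangentSpace (𝓡 n) x →L[ℝ] TangentSpace (𝓡 n) x →L[ℝ] TangentSpace (𝓡 n) x :=
  p.rep.1.difference (leviCivita g ⟨p.rep⟩) x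

/-- The vector field `X_g = (n + 1) / ((n + 2) (n - 1)) tr (g^♯ ⊗ (∇ - ᵍ∇)₀)`. -/
noncomputable def vectorX (p : ProjectiveStructure n M) (g : Metric n M) (x : M) :
    TangentSpace (𝓡 n) x :=
  (((n : ℝ) + 1) / (((n : ℝ) + 2) * ((n : ℝ) - 1))) •
    contract (tangentBasis x) (g.inner x) (traceFree (differenceLC p g x))

/-- The `End(TM)`-valued `1`-form `A_{[g]} = (∇ - ᵍ∇ - g ⊗ X_g)₀`, with `∇ ∈ 𝔭`. -/
noncomputable def tensorA (p : ProjectiveStructure n M) (g : Metric n M) (x : M) :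
    TangentSpace (𝓡 n) x →L[ℝ] TangentSpace (𝓡 n) x →L[ℝ] TangentSpace (𝓡 n) x :=
  traceFree (differenceLC p g x - tensorVec (g.inner x) (vectorX p g x))

/-- The Gram matrix `g_{kl} = g(∂_k, ∂_l)` of `g` with respect to the coordinate vector fields of
the preferred chart at `x₀`, at the point of `M` with coordinates `y`. -/
noncomputable def coordMetric (g : Metric n M) (x₀ : M) (y : EuclideanSpace ℝ (Fin n)) :
    Matrix (Fin n) (Fin n) ℝ :=
  let e := (chartAt (EuclideanSpace ℝ (Fin n)) x₀).symm
  Matrix.of fun k l => g.inner (e y)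
    (mfderiv (𝓡 n) (𝓡 n) e y (EuclideanSpace.basisFun (Fin n) ℝ k))
    (mfderiv (𝓡 n) (𝓡 n) e y (EuclideanSpace.basisFun (Fin n) ℝ l))

variable (n M) in
theorem exists_countable_chart_cover [SecondCountableTopology M] [Nonempty M] :
    ∃ c : ℕ → M, ⋃ i, (chartAt (EuclideanSpace ℝ (Fin n)) (c i)).source = Set.univ := by
  obtain ⟨s, hs, hU⟩ := TopologicalSpace.countable_cover_nhds
    (fun x : M => chart_source_mem_nhds (EuclideanSpace ℝ (Fin n)) x)
  have hne : s.Nonempty := by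
    by_contra h
    rw [Set.not_nonempty_iff_eq_empty] at h
    simp [h, Set.eq_univ_iff_forall] at hU
  obtain ⟨c, rfl⟩ := hs.exists_eq_range hne
  exact ⟨c, by simpa using hU⟩

/-- The integral `∫_M f dμ_g` of a function `f ≥ 0` against the Riemannian volume of `g`: `M` is
cut into countably many disjoint Borel pieces, each contained in a chart domain, and on each of
them `dμ_g` is `√(det g_{kl})` times the Lebesgue measure of the chart (by the change of variables
formula the result does not depend on the choices). -/
noncomputable def volumeIntegral [SecondCountableTopology M] [Nonempty M] (g : Metric n M)
    (f : M → ℝ≥0∞) : ℝ≥0∞ :=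
  let c := (exists_countable_chart_cover n M).choose
  let φ := fun i => chartAt (EuclideanSpace ℝ (Fin n)) (c i)
  ∑' i, ∫⁻ y in φ i '' disjointed (fun j => (φ j).source) i,
    f ((φ i).symm y) * ENNReal.ofReal (Real.sqrt (coordMetric g (c i) y).det)

/-- The functional `𝓔_𝔭([g]) = ∫_M |A_{[g]}|_g^n dμ_g ∈ [0, ∞]`. -/
noncomputable def energy [SecondCountableTopology M] [Nonempty M]
    (p : ProjectiveStructure n M) (g : Metric n M) : ℝ≥0∞ :=
  volumeIntegral g fun x =>
    ENNReal.ofReal (tensorNorm (tangentBasis x) (g.inner x) (tensorA p g x) ^ n)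

/-- The invariant `Γδ(M, 𝔭) = inf 𝓔_𝔭`. -/
noncomputable def infEnergy [SecondCountableTopology M] [Nonempty M]
    (p : ProjectiveStructure n M) : ℝ≥0∞ :=
  ⨅ g : Metric n M, energy p g

/-! ### Transformation groups, as sets of diffeomorphisms -/

/-- `Aff(M, ∇) = {Φ | Φ^*∇ = ∇}`. -/
def Aff (D : Connection n M) : Set (M ≃ₘ^∞⟮𝓡 n, 𝓡 n⟯ M) :=
  {Φ | SameConnection (pullback Φ D) D}

/-- `Proj(M, 𝔭) = {Φ | (Φ^*∇ - ∇)₀ = 0 for ∇ ∈ 𝔭}`. -/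
def Proj (p : ProjectiveStructure n M) : Set (M ≃ₘ^∞⟮𝓡 n, 𝓡 n⟯ M) :=
  {Φ | ∀ D : Connection n M, Represents D p → ∀ x,
    traceFree ((pullback Φ D).difference D x) = 0}

/-- `Conf(M, [g]) = {Φ | Φ^*g ∈ [g]}`, i.e. `Φ^*g = e^{2f} g` for a smooth function `f`. -/
def Conf (g : Metric n M) : Set (M ≃ₘ^∞⟮𝓡 n, 𝓡 n⟯ M) :=
  {Φ | ∃ f : M → ℝ, ContMDiff (𝓡 n) 𝓘(ℝ, ℝ) ∞ f ∧
    ∀ (x : M) (v w : TangentSpace (𝓡 n) x),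
      g.inner (Φ x) (mfderiv (𝓡 n) (𝓡 n) Φ x v) (mfderiv (𝓡 n) (𝓡 n) Φ x w)
        = Real.exp (2 * f x) * g.inner x v w}

end Manifold

end ProjConf

/-! Every step from `𝔭` and `[g]` to the energy is natural under diffeomorphisms. If `Φ` is
projective, then `Φ^*𝔭 = 𝔭`, so `𝓔_𝔭([Φ^*g]) = 𝓔_𝔭([g])`. Hence `Φ^*g` is again a minimiser, and
uniqueness forces `Φ^*g ∈ [g]`: projective maps are conformal for the minimiser. It follows that `Φ`
preserves `A_{[g]}` and that `Φ^*D` is again a `[g]`-conformal connection, where `D` denotes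
`^{[g]}∇`. Since `D + A_{[g]}` lies in `𝔭`, the difference `Φ^*D - D` is pure trace, and two
conformal connections whose difference is pure trace coincide. So `Φ` preserves `D + A_{[g]}`.
Conversely, an affine map of one representative of `𝔭` is projective (`aff_subset_proj`).

The invariance of `A_{[g]}` is linear algebra in `V* ⊗ V* ⊗ V`. Changing the representative of `𝔭`
adds some `ι(ν)`; changing the conformal connection adds `ι(η) - g ⊗ η^♯`. The tensor `A_{[g]}` is
the projection `primitivePart`, which kills `ι(V*)` and `g ⊗ V` when `n ≥ 2` (`primitivePart_add`).
Thus `A_{[g]}` can be computed from any representative and any conformal connection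
(`tensorA_eq_of_conformal`), which gives conformal invariance and `Φ^*A_{[g]} = A_{[Φ^*g]}` for
projective `Φ`. The injectivity of `Z ↦ (g ⊗ Z)₀` also gives uniqueness of the conformal connection.

Three analytic inputs remain. Projective equivalence is defined by geodesics, so Weyl's theorem
(`Represents.exists_difference_eq_iota`) is needed to turn it into the pure-trace condition; it
rests on local existence of geodesics (`exists_geodesic`). The connection `D` and the metric `Φ^*g`
must be shown smooth, which is tested on smooth vector fields. Finally `volumeIntegral_pullback`,
the change of variables formula over a chart decomposition, makes the energy invariant
(`energy_pullback`). -/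

namespace ProjConf

/-! ### Linear algebra of `V* ⊗ V* ⊗ V`: traces, contractions and the projection defining `A`. -/

section PointwiseAlgebra

set_option linter.unusedSectionVars false

variable {V : Type*} [AddCommGroup V] [Module ℝ V] [TopologicalSpace V] [IsTopologicalAddGroup V]
  [ContinuousSMul ℝ V] [FiniteDimensional ℝ V] [T2Space V]
variable {V' : Type*} [AddCommGroup V'] [Module ℝ V'] [TopologicalSpace V']
  [IsTopologicalAddGroup V'] [ContinuousSMul ℝ V'] [FiniteDimensional ℝ V'] [T2Space V']
variable {ι κ : Type*} [Fintype ι] [DecidableEq ι] [Fintype κ] [DecidableEq κ]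

@[simp]
theorem iota_apply (ν : V →L[ℝ] ℝ) (X Y : V) : iota ν X Y = ν X • Y + ν Y • X := rfl

@[simp]
theorem tensorVec_apply (B : V →L[ℝ] V →L[ℝ] ℝ) (Z X Y : V) :
    tensorVec B Z X Y = B X Y • Z := rfl

theorem tr_apply (v : V →L[ℝ] V →L[ℝ] V) (Y : V) :
    tr v Y = LinearMap.trace ℝ V ((ContinuousLinearMap.toLinearMap₁₂ v).flip Y) := rfl

theorem tr_add (v w : V →L[ℝ] V →L[ℝ] V) : tr (v + w) = tr v + tr w := by
  ext Y
  rw [_root_.add_apply, tr_apply, tr_apply, tr_apply, ← map_add]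
  rfl

theorem tr_smul (c : ℝ) (v : V →L[ℝ] V →L[ℝ] V) : tr (c • v) = c • tr v := by
  ext Y
  rw [_root_.smul_apply, tr_apply, tr_apply, ← map_smul]
  rfl

/-- The term `Id ⊗ ν` contributes `dim V` and `ν ⊗ Id` contributes `1`; this fixes the factor in
`traceFree`, so that `ι(ν)` has no trace-free part. -/
theorem tr_iota (ν : V →L[ℝ] ℝ) : tr (iota ν) = ((Module.finrank ℝ V : ℝ) + 1) • ν := by
  ext Y
  have h : (ContinuousLinearMap.toLinearMap₁₂ (iota ν)).flip Y
      = (ν : V →ₗ[ℝ] ℝ).smulRight Y + ν Y • LinearMap.id := by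
    ext X; rfl
  rw [tr_apply, h, map_add, map_smul, LinearMap.trace_id, LinearMap.trace_smulRight]
  simp only [ContinuousLinearMap.coe_coe, smul_eq_mul, _root_.smul_apply]
  ring

theorem tr_tensorVec (B : V →L[ℝ] V →L[ℝ] ℝ) (Z Y : V) : tr (tensorVec B Z) Y = B Z Y := by
  have h : (ContinuousLinearMap.toLinearMap₁₂ (tensorVec B Z)).flip Y
      = ((ContinuousLinearMap.toLinearMap₁₂ B).flip Y).smulRight Z := by
    ext X; rfl
  rw [tr_apply, h, LinearMap.trace_smulRight]
  rfl

theorem iota_add (ν μ : V →L[ℝ] ℝ) : iota (ν + μ) = iota ν + iota μ := by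
  ext X Y
  simp only [iota_apply, _root_.add_apply]
  module

theorem iota_smul (c : ℝ) (ν : V →L[ℝ] ℝ) : iota (c • ν) = c • iota ν := by
  ext X Y
  simp only [iota_apply, _root_.smul_apply, smul_eq_mul]
  module

theorem iota_neg (ν : V →L[ℝ] ℝ) : iota (-ν) = -iota ν := by
  ext X Y
  simp only [iota_apply, _root_.neg_apply]
  module

theorem tensorVec_add (B : V →L[ℝ] V →L[ℝ] ℝ) (Z W : V) :
    tensorVec B (Z + W) = tensorVec B Z + tensorVec B W := by
  ext X Y
  simp only [tensorVec_apply, _root_.add_apply, smul_add]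

theorem tensorVec_smul (c : ℝ) (B : V →L[ℝ] V →L[ℝ] ℝ) (Z : V) :
    tensorVec (c • B) Z = tensorVec B (c • Z) := by
  ext X Y
  simp only [tensorVec_apply, _root_.smul_apply, smul_eq_mul]
  module

theorem traceFree_add (v w : V →L[ℝ] V →L[ℝ] V) :
    traceFree (v + w) = traceFree v + traceFree w := by
  ext X Y
  simp only [traceFree, tr_add, iota_add, _root_.add_apply, _root_.sub_apply, _root_.smul_apply]
  module

theorem traceFree_smul (c : ℝ) (v : V →L[ℝ] V →L[ℝ] V) :
    traceFree (c • v) = c • traceFree v := by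
  ext X Y
  simp only [traceFree, tr_smul, iota_smul, _root_.sub_apply, _root_.smul_apply]
  module

theorem traceFree_neg (v : V →L[ℝ] V →L[ℝ] V) : traceFree (-v) = -traceFree v := by
  have h : -v = (-1 : ℝ) • v := by
    ext X Y
    simp
  rw [h, traceFree_smul]
  ext X Y
  simp

theorem traceFree_sub (v w : V →L[ℝ] V →L[ℝ] V) :
    traceFree (v - w) = traceFree v - traceFree w := by
  rw [sub_eq_add_neg, traceFree_add, traceFree_neg, sub_eq_add_neg]

theorem traceFree_iota (ν : V →L[ℝ] ℝ) : traceFree (iota ν) = 0 := by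
  have h : (Module.finrank ℝ V : ℝ) + 1 ≠ 0 := by positivity
  rw [traceFree, tr_iota, iota_smul, smul_smul, inv_mul_cancel₀ h, one_smul, sub_self]

theorem traceFree_add_iota (v : V →L[ℝ] V →L[ℝ] V) (ν : V →L[ℝ] ℝ) :
    traceFree (v + iota ν) = traceFree v := by
  rw [traceFree_add, traceFree_iota]
  ext X Y
  exact add_zero (traceFree v X Y)

theorem exists_eq_iota_of_traceFree_eq_zero {v : V →L[ℝ] V →L[ℝ] V} (h : traceFree v = 0) :
    ∃ ν, v = iota ν :=
  ⟨((Module.finrank ℝ V : ℝ) + 1)⁻¹ • tr v, by rw [iota_smul]; exact sub_eq_zero.mp h⟩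

theorem traceFree_symm {v : V →L[ℝ] V →L[ℝ] V} (h : ∀ X Y, v X Y = v Y X) (X Y : V) :
    traceFree v X Y = traceFree v Y X := by
  simp only [traceFree, _root_.sub_apply, _root_.smul_apply, iota_apply, h X Y]
  rw [add_comm (tr v X • Y)]

theorem tr_map (e : V ≃L[ℝ] V') {v : V →L[ℝ] V →L[ℝ] V} {v' : V' →L[ℝ] V' →L[ℝ] V'}
    (h : ∀ X Y, e (v X Y) = v' (e X) (e Y)) (Y : V) : tr v' (e Y) = tr v Y := by
  rw [tr_apply, tr_apply, ← LinearMap.trace_conj' _ e.toLinearEquiv]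
  congr 1
  ext X
  obtain ⟨X, rfl⟩ := e.surjective X
  rw [LinearEquiv.conj_apply]
  change v' (e X) (e Y) = e (v (e.symm (e X)) Y)
  rw [e.symm_apply_apply, h]

theorem traceFree_map (e : V ≃L[ℝ] V') {v : V →L[ℝ] V →L[ℝ] V} {v' : V' →L[ℝ] V' →L[ℝ] V'}
    (h : ∀ X Y, e (v X Y) = v' (e X) (e Y)) (X Y : V) :
    e (traceFree v X Y) = traceFree v' (e X) (e Y) := by
  simp only [traceFree, _root_.sub_apply, _root_.smul_apply, iota_apply, map_sub, map_smul,
    map_add, h, tr_map e h, e.toLinearEquiv.finrank_eq]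

/-! ### Contraction with a scalar product -/

/-- A kernel vector of the Gram matrix would be the coordinate vector of a non-zero `v` with `B v v
= 0`. -/
theorem isUnit_det_gram (b : Module.Basis ι ℝ V) {B : V →L[ℝ] V →L[ℝ] ℝ}
    (hp : ∀ v, v ≠ 0 → 0 < B v v) : IsUnit (gram b B).det := by
  rw [isUnit_iff_ne_zero]
  intro h0
  obtain ⟨x, hx, h⟩ := Matrix.exists_mulVec_eq_zero_iff.mpr h0
  have hv : ∑ i, x i • b i ≠ 0 := by
    intro h1
    apply hx
    ext i
    exact Fintype.linearIndependent_iff.mp b.linearIndependent x h1 i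
  have h2 := hp _ hv
  have h3 : B (∑ i, x i • b i) (∑ i, x i • b i) = ∑ i, x i * (gram b B).mulVec x i := by
    simp only [map_sum, map_smul, _root_.sum_apply, _root_.smul_apply, smul_eq_mul,
      Matrix.mulVec, dotProduct, gram, Matrix.of_apply, Finset.mul_sum]
    rw [Finset.sum_comm]
    refine Finset.sum_congr rfl fun i _ => Finset.sum_congr rfl fun j _ => ?_
    ring
  rw [h3, h] at h2
  simp at h2

theorem repr_eq_sum_gram_inv (b : Module.Basis ι ℝ V) {B : V →L[ℝ] V →L[ℝ] ℝ}
    (hp : ∀ v, v ≠ 0 → 0 < B v v) (u : V) (i : ι) :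
    b.repr u i = ∑ j, (gram b B)⁻¹ i j * B (b j) u := by
  have h1 : ∀ j, B (b j) u = ∑ k, gram b B j k * b.repr u k := by
    intro j
    conv_lhs => rw [← b.sum_repr u]
    simp only [map_sum, map_smul, smul_eq_mul, gram, Matrix.of_apply, mul_comm]
  have h3 := congrFun (congrArg (fun A : Matrix ι ι ℝ => A.mulVec (b.repr u))
    (Matrix.nonsing_inv_mul _ (isUnit_det_gram b hp))) i
  simp only [Matrix.one_mulVec, ← Matrix.mulVec_mulVec] at h3
  rw [← h3]
  simp only [Matrix.mulVec, dotProduct, h1]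

theorem eq_sum_gram_inv (b : Module.Basis ι ℝ V) {B : V →L[ℝ] V →L[ℝ] ℝ}
    (hp : ∀ v, v ≠ 0 → 0 < B v v) (u : V) :
    u = ∑ i, ∑ j, ((gram b B)⁻¹ i j * B (b j) u) • b i := by
  simp only [← Finset.sum_smul, ← repr_eq_sum_gram_inv b hp u]
  exact (b.sum_repr u).symm

theorem gram_inv_symm (b : Module.Basis ι ℝ V) {B : V →L[ℝ] V →L[ℝ] ℝ}
    (hs : ∀ u v, B u v = B v u) (i j : ι) : (gram b B)⁻¹ i j = (gram b B)⁻¹ j i := by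
  have h : (gram b B).transpose = gram b B := by
    ext i j
    exact hs _ _
  rw [← Matrix.transpose_apply (gram b B)⁻¹ i j, Matrix.transpose_nonsing_inv, h]

/-- The contraction of a bilinear map with the dual of a scalar product does not depend on the
basis. -/
theorem sum_gram_inv_eq {W : Type*} [AddCommGroup W] [Module ℝ W] (b : Module.Basis ι ℝ V)
    (b' : Module.Basis κ ℝ V) {B : V →L[ℝ] V →L[ℝ] ℝ} (hs : ∀ u v, B u v = B v u)
    (hp : ∀ v, v ≠ 0 → 0 < B v v) (F : V →ₗ[ℝ] V →ₗ[ℝ] W) :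
    ∑ i, ∑ j, (gram b B)⁻¹ i j • F (b i) (b j) =
      ∑ k, ∑ l, (gram b' B)⁻¹ k l • F (b' k) (b' l) := by
  -- Expanding the first argument on the right in `b`, and the second argument on the left in `b'`,
  -- brings both sides to the same fourfold sum over the mixed values `F (b i) (b' l)`.
  have h1 : ∀ k l, F (b' k) (b' l) =
      ∑ i, ∑ j, ((gram b B)⁻¹ i j * B (b j) (b' k)) • F (b i) (b' l) := by
    intro k l
    conv_lhs => rw [eq_sum_gram_inv b hp (b' k)]
    simp only [map_sum, map_smul, LinearMap.sum_apply, LinearMap.smul_apply]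
  have h2 : ∀ i j, F (b i) (b j) =
      ∑ l, ∑ k, ((gram b' B)⁻¹ l k * B (b' k) (b j)) • F (b i) (b' l) := by
    intro i j
    conv_lhs => rw [eq_sum_gram_inv b' hp (b j)]
    simp only [map_sum, map_smul]
  simp only [h1]
  simp only [h2, Finset.smul_sum, smul_smul]
  have h3 : ∀ f : ι → ι → κ → κ → W, ∑ i, ∑ j, ∑ l, ∑ k, f i j l k
      = ∑ k, ∑ l, ∑ i, ∑ j, f i j l k := by
    intro f
    simp_rw [Finset.sum_comm (s := (Finset.univ : Finset ι)) (t := (Finset.univ : Finset κ))]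
    rw [Finset.sum_comm]
  rw [h3]
  refine Finset.sum_congr rfl fun k _ => Finset.sum_congr rfl fun l _ =>
    Finset.sum_congr rfl fun i _ => Finset.sum_congr rfl fun j _ => ?_
  rw [gram_inv_symm b' hs l k, hs (b' k)]
  congr 1
  ring

theorem contract_eq_of_basis (b : Module.Basis ι ℝ V) (b' : Module.Basis κ ℝ V)
    {B : V →L[ℝ] V →L[ℝ] ℝ} (hs : ∀ u v, B u v = B v u) (hp : ∀ v, v ≠ 0 → 0 < B v v)
    (v : V →L[ℝ] V →L[ℝ] V) : contract b B v = contract b' B v :=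
  sum_gram_inv_eq b b' hs hp (ContinuousLinearMap.toLinearMap₁₂ v)

theorem tensorNorm_eq_sqrt (b : Module.Basis ι ℝ V) (B : V →L[ℝ] V →L[ℝ] ℝ)
    (v : V →L[ℝ] V →L[ℝ] V) : tensorNorm b B v =
      Real.sqrt (∑ i, ∑ k, (gram b B)⁻¹ i k • ∑ j, ∑ l, (gram b B)⁻¹ j l •
        B (v (b i) (b j)) (v (b k) (b l))) := by
  rw [tensorNorm]
  congr 1
  refine Finset.sum_congr rfl fun i _ => ?_
  rw [Finset.sum_comm]
  simp only [smul_eq_mul, Finset.mul_sum, mul_assoc]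

/-- The squared norm is an iterated contraction: the basis is exchanged in the second slots for
fixed first arguments (`h1`), and then in the first slots (`h2`). -/
theorem tensorNorm_eq_of_basis (b : Module.Basis ι ℝ V) (b' : Module.Basis κ ℝ V)
    {B : V →L[ℝ] V →L[ℝ] ℝ} (hs : ∀ u v, B u v = B v u) (hp : ∀ v, v ≠ 0 → 0 < B v v)
    (v : V →L[ℝ] V →L[ℝ] V) : tensorNorm b B v = tensorNorm b' B v := by
  have h1 (c : Module.Basis κ ℝ V) (X Y : V) :=
    sum_gram_inv_eq b c hs hp (LinearMap.mk₂ ℝ (fun Z W : V => B (v X Z) (v Y W))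
      (fun _ _ _ => by simp only [map_add, _root_.add_apply])
      (fun _ _ _ => by simp only [map_smul, _root_.smul_apply])
      (fun _ _ _ => by simp only [map_add]) (fun _ _ _ => by simp only [map_smul]))
  have h2 := sum_gram_inv_eq b b' hs hp (LinearMap.mk₂ ℝ
    (fun X Y : V => ∑ k, ∑ l, (gram b' B)⁻¹ k l • B (v X (b' k)) (v Y (b' l)))
    (fun _ _ _ => by simp only [map_add, _root_.add_apply, smul_add, Finset.sum_add_distrib])
    (fun _ _ _ => by
      simp only [map_smul, _root_.smul_apply, smul_eq_mul, Finset.mul_sum, mul_left_comm])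
    (fun _ _ _ => by simp only [map_add, _root_.add_apply, smul_add, Finset.sum_add_distrib])
    (fun _ _ _ => by
      simp only [map_smul, _root_.smul_apply, smul_eq_mul, Finset.mul_sum, mul_left_comm]))
  simp only [LinearMap.mk₂_apply] at h1 h2
  simp only [← h1 b'] at h2
  rw [tensorNorm_eq_sqrt, tensorNorm_eq_sqrt, h2]
  simp only [h1 b']

/-- The pull-back of a bilinear form under a linear isomorphism. -/
noncomputable def pullbackForm (e : V ≃L[ℝ] V') (B : V' →L[ℝ] V' →L[ℝ] ℝ) : V →L[ℝ] V →L[ℝ] ℝ :=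
  (LinearMap.mk₂ ℝ (fun X Y : V => B (e X) (e Y))
    (fun X X' Y => by simp only [map_add, _root_.add_apply])
    (fun c X Y => by simp only [map_smul, _root_.smul_apply])
    (fun X Y Y' => by simp only [map_add])
    (fun c X Y => by simp only [map_smul])).toContinuousBilinearMap

theorem gram_map (e : V ≃L[ℝ] V') (b : Module.Basis ι ℝ V) {B : V →L[ℝ] V →L[ℝ] ℝ}
    {B' : V' →L[ℝ] V' →L[ℝ] ℝ} (hB : ∀ X Y, B X Y = B' (e X) (e Y)) :
    gram (b.map e.toLinearEquiv) B' = gram b B := by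
  ext i j
  exact (hB _ _).symm

/-- The image basis `b.map e` has the same Gram matrix as `b`, so naturality reduces to independence
of the basis. -/
theorem contract_map (e : V ≃L[ℝ] V') (b : Module.Basis ι ℝ V) (b' : Module.Basis κ ℝ V')
    {B : V →L[ℝ] V →L[ℝ] ℝ} {B' : V' →L[ℝ] V' →L[ℝ] ℝ} (hs : ∀ u v, B' u v = B' v u)
    (hp : ∀ v, v ≠ 0 → 0 < B' v v) (hB : ∀ X Y, B X Y = B' (e X) (e Y))
    {v : V →L[ℝ] V →L[ℝ] V} {v' : V' →L[ℝ] V' →L[ℝ] V'}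
    (hv : ∀ X Y, e (v X Y) = v' (e X) (e Y)) : e (contract b B v) = contract b' B' v' := by
  rw [contract_eq_of_basis b' (b.map e.toLinearEquiv) hs hp, contract, contract, gram_map e b hB]
  simp only [map_sum, map_smul, hv]
  rfl

theorem tensorNorm_map (e : V ≃L[ℝ] V') (b : Module.Basis ι ℝ V) (b' : Module.Basis κ ℝ V')
    {B : V →L[ℝ] V →L[ℝ] ℝ} {B' : V' →L[ℝ] V' →L[ℝ] ℝ} (hs : ∀ u v, B' u v = B' v u)
    (hp : ∀ v, v ≠ 0 → 0 < B' v v) (hB : ∀ X Y, B X Y = B' (e X) (e Y))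
    {v : V →L[ℝ] V →L[ℝ] V} {v' : V' →L[ℝ] V' →L[ℝ] V'}
    (hv : ∀ X Y, e (v X Y) = v' (e X) (e Y)) : tensorNorm b B v = tensorNorm b' B' v' := by
  rw [tensorNorm_eq_of_basis b' (b.map e.toLinearEquiv) hs hp, tensorNorm, tensorNorm,
    gram_map e b hB]
  simp only [hB, hv]
  rfl

theorem contract_add (b : Module.Basis ι ℝ V) (B : V →L[ℝ] V →L[ℝ] ℝ)
    (v w : V →L[ℝ] V →L[ℝ] V) : contract b B (v + w) = contract b B v + contract b B w := by
  simp only [contract, _root_.add_apply, smul_add, Finset.sum_add_distrib]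

theorem contract_sub (b : Module.Basis ι ℝ V) (B : V →L[ℝ] V →L[ℝ] ℝ)
    (v w : V →L[ℝ] V →L[ℝ] V) : contract b B (v - w) = contract b B v - contract b B w := by
  simp only [contract, _root_.sub_apply, smul_sub, Finset.sum_sub_distrib]

theorem contract_smul_right (b : Module.Basis ι ℝ V) (B : V →L[ℝ] V →L[ℝ] ℝ) (c : ℝ)
    (v : V →L[ℝ] V →L[ℝ] V) : contract b B (c • v) = c • contract b B v := by
  simp only [contract, _root_.smul_apply, Finset.smul_sum, smul_comm c]

theorem contract_smul_left (b : Module.Basis ι ℝ V) {B : V →L[ℝ] V →L[ℝ] ℝ}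
    (hp : ∀ v, v ≠ 0 → 0 < B v v) {c : ℝ} (hc : c ≠ 0) (v : V →L[ℝ] V →L[ℝ] V) :
    contract b (c • B) v = c⁻¹ • contract b B v := by
  have h1 : gram b (c • B) = c • gram b B := by
    ext i j
    rfl
  have h2 : (c • gram b B)⁻¹ = c⁻¹ • (gram b B)⁻¹ := by
    refine Matrix.inv_eq_right_inv ?_
    rw [Matrix.smul_mul, Matrix.mul_smul, smul_smul, mul_inv_cancel₀ hc, one_smul,
      Matrix.mul_nonsing_inv _ (isUnit_det_gram b hp)]
  simp only [contract, h1, h2, Finset.smul_sum, Matrix.smul_apply, smul_smul, smul_eq_mul]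

theorem contract_iota (b : Module.Basis ι ℝ V) {B : V →L[ℝ] V →L[ℝ] ℝ}
    (hs : ∀ u v, B u v = B v u) (hp : ∀ v, v ≠ 0 → 0 < B v v) {ν : V →L[ℝ] ℝ} {Z : V}
    (hZ : ∀ w, B Z w = ν w) : contract b B (iota ν) = (2 : ℝ) • Z := by
  have h1 : ∑ i, ∑ j, (gram b B)⁻¹ i j • ν (b j) • b i = Z := by
    conv_rhs => rw [eq_sum_gram_inv b hp Z]
    simp only [smul_smul, ← hZ, hs Z]
  have h2 : ∑ i, ∑ j, (gram b B)⁻¹ i j • ν (b i) • b j = Z := by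
    rw [Finset.sum_comm]
    simpa only [gram_inv_symm b hs] using h1
  simp only [contract, iota_apply, smul_add, Finset.sum_add_distrib]
  rw [h1, h2, two_smul]

theorem contract_tensorVec (b : Module.Basis ι ℝ V) {B : V →L[ℝ] V →L[ℝ] ℝ}
    (hs : ∀ u v, B u v = B v u) (hp : ∀ v, v ≠ 0 → 0 < B v v) (Z : V) :
    contract b B (tensorVec B Z) = (Module.finrank ℝ V : ℝ) • Z := by
  have h : ∑ i, ∑ j, (gram b B)⁻¹ i j * B (b i) (b j) = (Fintype.card ι : ℝ) := by
    rw [← Matrix.trace_one, ← Matrix.nonsing_inv_mul _ (isUnit_det_gram b hp)]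
    simp only [Matrix.trace, Matrix.diag, Matrix.mul_apply]
    refine Finset.sum_congr rfl fun i _ => Finset.sum_congr rfl fun j _ => ?_
    rw [hs]
    rfl
  simp only [contract, tensorVec_apply, smul_smul, ← Finset.sum_smul]
  rw [h, Module.finrank_eq_card_basis b]

/-- With `n = dim V`, the contraction of `B ⊗ Z` is `n Z`, and its trace part `ι(B Z) / (n + 1)`
contributes `2 Z / (n + 1)`. The factor `n - 2 / (n + 1)` is the reciprocal of the normalisation of
`X_g`, and it is non-zero for `n ≥ 2`. -/
theorem contract_traceFree_tensorVec (b : Module.Basis ι ℝ V) {B : V →L[ℝ] V →L[ℝ] ℝ}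
    (hs : ∀ u v, B u v = B v u) (hp : ∀ v, v ≠ 0 → 0 < B v v) (Z : V) :
    contract b B (traceFree (tensorVec B Z)) =
      (((Module.finrank ℝ V : ℝ) + 2) * ((Module.finrank ℝ V : ℝ) - 1) /
        ((Module.finrank ℝ V : ℝ) + 1)) • Z := by
  have h : (Module.finrank ℝ V : ℝ) + 1 ≠ 0 := by positivity
  rw [traceFree, contract_sub, contract_smul_right, contract_tensorVec b hs hp,
    contract_iota b hs hp (Z := Z) fun w => (tr_tensorVec B Z w).symm, smul_smul, ← sub_smul]
  congr 1
  field_simp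
  ring

theorem eq_zero_of_traceFree_tensorVec_eq_zero (hd : 2 ≤ Module.finrank ℝ V)
    {B : V →L[ℝ] V →L[ℝ] ℝ} (hs : ∀ u v, B u v = B v u) (hp : ∀ v, v ≠ 0 → 0 < B v v) {Z : V}
    (h : traceFree (tensorVec B Z) = 0) : Z = 0 := by
  have h1 := contract_traceFree_tensorVec (Module.finBasis ℝ V) hs hp Z
  rw [h] at h1
  have h2 : (2 : ℝ) ≤ Module.finrank ℝ V := by exact_mod_cast hd
  have h3 : ((Module.finrank ℝ V : ℝ) + 2) * ((Module.finrank ℝ V : ℝ) - 1) /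
        ((Module.finrank ℝ V : ℝ) + 1) ≠ 0 := by
    refine div_ne_zero (mul_ne_zero ?_ ?_) ?_ <;> linarith
  refine (smul_eq_zero.mp (h1.symm.trans ?_)).resolve_left h3
  simp [contract]

/-- The vector `(n + 1) / ((n + 2) (n - 1)) tr (B^♯ ⊗ v₀)`. -/
noncomputable def correctionVec (b : Module.Basis ι ℝ V) (B : V →L[ℝ] V →L[ℝ] ℝ)
    (v : V →L[ℝ] V →L[ℝ] V) : V :=
  (((Module.finrank ℝ V : ℝ) + 1) /
    (((Module.finrank ℝ V : ℝ) + 2) * ((Module.finrank ℝ V : ℝ) - 1))) •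
    contract b B (traceFree v)

/-- The projection of `v` to the trace-free tensors with vanishing contraction. -/
noncomputable def primitivePart (b : Module.Basis ι ℝ V) (B : V →L[ℝ] V →L[ℝ] ℝ)
    (v : V →L[ℝ] V →L[ℝ] V) : V →L[ℝ] V →L[ℝ] V :=
  traceFree (v - tensorVec B (correctionVec b B v))

theorem correctionVec_add (hd : 2 ≤ Module.finrank ℝ V) (b : Module.Basis ι ℝ V)
    {B : V →L[ℝ] V →L[ℝ] ℝ} (hs : ∀ u v, B u v = B v u) (hp : ∀ v, v ≠ 0 → 0 < B v v)
    (v : V →L[ℝ] V →L[ℝ] V) (Y : V) (ν : V →L[ℝ] ℝ) :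
    correctionVec b B (v + tensorVec B Y + iota ν) = correctionVec b B v + Y := by
  have h2 : (2 : ℝ) ≤ Module.finrank ℝ V := by exact_mod_cast hd
  have h3 : (Module.finrank ℝ V : ℝ) - 1 ≠ 0 := by linarith
  have h4 : traceFree (v + tensorVec B Y + iota ν) =
      traceFree v + traceFree (tensorVec B Y) := by
    rw [traceFree_add_iota, traceFree_add]
  rw [correctionVec, correctionVec, h4, contract_add, smul_add, contract_traceFree_tensorVec b hs hp, smul_smul]
  congr 1
  convert one_smul ℝ Y
  field_simp

/-- The correction vector absorbs `Y` exactly and `traceFree` kills `ι(ν)`. These are the two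
ambiguities caused by the choice of conformal connection and of projective representative. -/
theorem primitivePart_add (hd : 2 ≤ Module.finrank ℝ V) (b : Module.Basis ι ℝ V)
    {B : V →L[ℝ] V →L[ℝ] ℝ} (hs : ∀ u v, B u v = B v u) (hp : ∀ v, v ≠ 0 → 0 < B v v)
    (v : V →L[ℝ] V →L[ℝ] V) (Y : V) (ν : V →L[ℝ] ℝ) :
    primitivePart b B (v + tensorVec B Y + iota ν) = primitivePart b B v := by
  rw [primitivePart, primitivePart, correctionVec_add hd b hs hp, tensorVec_add]
  have h : v + tensorVec B Y + iota ν - (tensorVec B (correctionVec b B v) + tensorVec B Y)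
      = (v - tensorVec B (correctionVec b B v)) + iota ν := by
    ext X Y
    simp only [_root_.add_apply, _root_.sub_apply]
    abel
  rw [h, traceFree_add_iota]

/-- The dual scalar product scales by `c⁻¹`, hence so does the correction vector, and its product
with `c • B` is unchanged. -/
theorem primitivePart_smul_left (b : Module.Basis ι ℝ V) {B : V →L[ℝ] V →L[ℝ] ℝ}
    (hp : ∀ v, v ≠ 0 → 0 < B v v) {c : ℝ} (hc : c ≠ 0) (v : V →L[ℝ] V →L[ℝ] V) :
    primitivePart b (c • B) v = primitivePart b B v := by
  rw [primitivePart, primitivePart, correctionVec, contract_smul_left b hp hc, tensorVec_smul,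
    smul_comm, smul_inv_smul₀ hc, correctionVec]

theorem primitivePart_map (e : V ≃L[ℝ] V') (b : Module.Basis ι ℝ V) (b' : Module.Basis κ ℝ V')
    {B : V →L[ℝ] V →L[ℝ] ℝ} {B' : V' →L[ℝ] V' →L[ℝ] ℝ} (hs : ∀ u v, B' u v = B' v u)
    (hp : ∀ v, v ≠ 0 → 0 < B' v v) (hB : ∀ X Y, B X Y = B' (e X) (e Y))
    {v : V →L[ℝ] V →L[ℝ] V} {v' : V' →L[ℝ] V' →L[ℝ] V'}
    (hv : ∀ X Y, e (v X Y) = v' (e X) (e Y)) (X Y : V) :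
    e (primitivePart b B v X Y) = primitivePart b' B' v' (e X) (e Y) := by
  refine traceFree_map e (fun X Y => ?_) X Y
  have h : e (correctionVec b B v) = correctionVec b' B' v' := by
    rw [correctionVec, correctionVec, map_smul, e.toLinearEquiv.finrank_eq,
      contract_map e b b' hs hp hB (traceFree_map e hv)]
  simp only [_root_.sub_apply, tensorVec_apply, map_sub, map_smul, hv, hB, h]

/-! ### Weyl structures -/

/-- The trilinear form `B (K u v) w` is symmetric in the first two arguments and skew in the first
and third, hence zero. This is the uniqueness argument for the Levi-Civita connection. -/
theorem eq_zero_of_symm_of_skew {B : V →L[ℝ] V →L[ℝ] ℝ} (hs : ∀ u v, B u v = B v u)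
    (hp : ∀ v, v ≠ 0 → 0 < B v v) {K : V →L[ℝ] V →L[ℝ] V} (hK : ∀ u v, K u v = K v u)
    (h : ∀ u w v, B (K u v) w + B u (K w v) = 0) : K = 0 := by
  have h1 : ∀ u v w, B (K u v) w = 0 := by
    intro u v w
    have e1 := h u w v
    have e2 := h v w u
    have e3 := h u v w
    rw [hs u, hK w v] at e1
    rw [hs v, hK w u, hK v u] at e2
    rw [hs u] at e3
    linarith
  ext u v
  by_contra hne
  exact (hp _ hne).ne' (h1 u v _)

theorem exists_dual {B : V →L[ℝ] V →L[ℝ] ℝ} (hp : ∀ v, v ≠ 0 → 0 < B v v) (η : V →L[ℝ] ℝ) :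
    ∃ Z, ∀ w, B Z w = η w := by
  have hinj : Function.Injective (ContinuousLinearMap.toLinearMap₁₂ B) := by
    rw [← LinearMap.ker_eq_bot, LinearMap.ker_eq_bot']
    intro u hu
    by_contra hne
    exact (hp u hne).ne' (congrArg (fun L : V →ₗ[ℝ] ℝ => L u) hu)
  obtain ⟨Z, hZ⟩ := (LinearMap.injective_iff_surjective_of_finrank_eq_finrank
    (Subspace.dual_finrank_eq (K := ℝ) (V := V)).symm).mp hinj (η : V →ₗ[ℝ] ℝ)
  exact ⟨Z, fun w => congrArg (fun L : V →ₗ[ℝ] ℝ => L w) hZ⟩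

/-- This is the shape of the difference of two Weyl connections of one metric. The right-hand side
satisfies the same equation as `K`, so the previous uniqueness argument applies to their difference.
-/
theorem eq_iota_sub_tensorVec {B : V →L[ℝ] V →L[ℝ] ℝ} (hs : ∀ u v, B u v = B v u)
    (hp : ∀ v, v ≠ 0 → 0 < B v v) {K : V →L[ℝ] V →L[ℝ] V} (hK : ∀ u v, K u v = K v u)
    {η : V →L[ℝ] ℝ} {Z : V} (hZ : ∀ w, B Z w = η w)
    (h : ∀ u w v, B (K u v) w + B u (K w v) = 2 * η v * B u w) :
    K = iota η - tensorVec B Z := by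
  rw [← sub_eq_zero]
  refine eq_zero_of_symm_of_skew hs hp (fun u v => ?_) fun u w v => ?_
  · simp only [_root_.sub_apply, iota_apply, tensorVec_apply, hK u v, hs u v]
    rw [add_comm (η u • v)]
  · have h1 := h u w v
    simp only [_root_.sub_apply, iota_apply, tensorVec_apply, map_sub, map_add, map_smul,
      _root_.add_apply, _root_.smul_apply, smul_eq_mul, hZ, hs u Z]
    rw [hs v w]
    linarith

/-- By the previous formula the trace-free part of `K` is `-(B ⊗ η^♯)₀`, and in dimension at least
two this vanishes only if `η = 0`. -/
theorem eq_zero_of_eq_iota (hd : 2 ≤ Module.finrank ℝ V) {B : V →L[ℝ] V →L[ℝ] ℝ}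
    (hs : ∀ u v, B u v = B v u) (hp : ∀ v, v ≠ 0 → 0 < B v v) {K : V →L[ℝ] V →L[ℝ] V}
    (hK : ∀ u v, K u v = K v u) {η : V →L[ℝ] ℝ}
    (h : ∀ u w v, B (K u v) w + B u (K w v) = 2 * η v * B u w) (h0 : traceFree K = 0) :
    K = 0 := by
  obtain ⟨Z, hZ⟩ := exists_dual hp η
  have h1 := eq_iota_sub_tensorVec hs hp hK hZ h
  rw [h1, traceFree_sub, traceFree_iota, zero_sub, neg_eq_zero] at h0
  have h2 := eq_zero_of_traceFree_tensorVec_eq_zero hd hs hp h0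
  rw [h1]
  have h3 : η = 0 := by
    ext w
    rw [← hZ, h2, map_zero]
  ext X Y
  simp [h2, h3]

/-- A symmetric bilinear map `S` such that `S(v, v)` is always a multiple of `v` is pure trace. -/
theorem exists_eq_iota_of_diag {S : V →L[ℝ] V →L[ℝ] V} (hS : ∀ u v, S u v = S v u)
    (h : ∀ v, ∃ c : ℝ, S v v = c • v) : ∃ ν : V →L[ℝ] ℝ, S = iota ν := by
  -- The factor is undetermined at `v = 0`; normalising it to `0` there allows the factor to be
  -- linear on all of `V`.
  have h' : ∀ v, ∃ c : ℝ, S v v = c • v ∧ (v = 0 → c = 0) := by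
    intro v
    by_cases hv : v = 0
    · exact ⟨0, by simp [hv], fun _ => rfl⟩
    · obtain ⟨c, hc⟩ := h v
      exact ⟨c, hc, fun h0 => absurd h0 hv⟩
  choose l hl hl0 using h'
  have hsmul : ∀ (c : ℝ) v, l (c • v) = c * l v := by
    intro c v
    by_cases h0 : c • v = 0
    · rw [hl0 _ h0]
      rcases smul_eq_zero.mp h0 with h1 | h1
      · rw [h1, zero_mul]
      · rw [hl0 _ h1, mul_zero]
    · have e := hl (c • v)
      simp only [map_smul, _root_.smul_apply, hl v, smul_smul] at e
      have hc : c ≠ 0 := fun hc => h0 (by rw [hc, zero_smul])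
      have hv : v ≠ 0 := fun hv => h0 (by rw [hv, smul_zero])
      have e' := smul_left_injective ℝ hv e
      refine mul_right_cancel₀ hc ?_
      linarith
  have hadd : ∀ u w, l (u + w) = l u + l w := by
    intro u w
    by_cases hli : LinearIndependent ℝ ![u, w]
    · have e1 := hl (u + w)
      have e2 := hl (u - w)
      simp only [map_add, map_sub, _root_.add_apply, _root_.sub_apply, hl u, hl w,
        hS w u] at e1 e2
      have e3 : (l (u + w) + l (u - w) - 2 * l u) • u + (l (u + w) - l (u - w) - 2 * l w) • w
          = 0 := by
        have e4 : (l (u + w) • (u + w)) + l (u - w) • (u - w)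
          = (2 * l u) • u + (2 * l w) • w := by
          rw [← e1, ← e2]
          module
        have e5 : (l (u + w) + l (u - w) - 2 * l u) • u + (l (u + w) - l (u - w) - 2 * l w) • w
          = (l (u + w) • (u + w)) + l (u - w) • (u - w) - ((2 * l u) • u + (2 * l w) • w) := by
          module
        rw [e5, e4, sub_self]
      obtain ⟨e6, e7⟩ := LinearIndependent.pair_iff.mp hli _ _ e3
      linarith
    · rw [LinearIndependent.pair_iff] at hli
      push Not at hli
      obtain ⟨s, t, e, hst⟩ := hli
      by_cases hs0 : s = 0
      · have ht := hst hs0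
        rw [hs0, zero_smul, zero_add] at e
        rw [(smul_eq_zero.mp e).resolve_left ht, add_zero, hl0 0 rfl, add_zero]
      · have hu : u = (-(t / s)) • w := by
          have : s • u = (-t) • w := by
            rw [neg_smul]
            exact eq_neg_of_add_eq_zero_left e
          rw [← inv_smul_smul₀ hs0 u, this, smul_smul]
          congr 1
          field_simp
        have : u + w = (-(t / s) + 1) • w := by
          rw [hu]
          module
        rw [this, hsmul, hu, hsmul]
        ring
  -- The factor one half appears because `ι(ν)(v, v) = 2 ν(v) v`; polarisation then recovers all of
  -- `S`.
  let ν : V →L[ℝ] ℝ := LinearMap.toContinuousLinearMap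
    { toFun := fun v => 2⁻¹ * l v
      map_add' := fun u w => by rw [hadd]; ring
      map_smul' := fun c v => by rw [hsmul, RingHom.id_apply, smul_eq_mul]; ring }
  refine ⟨ν, ?_⟩
  have hν : ∀ v, ν v = 2⁻¹ * l v := fun _ => rfl
  ext u w
  have e1 := hl (u + w)
  simp only [map_add, _root_.add_apply, hl u, hl w, hS w u, hadd] at e1
  have e2 : (2 : ℝ) • S u w = l w • u + l u • w := by
    have : (2 : ℝ) • S u w = l u • u + S u w + (S u w + l w • w) - l u • u - l w • w := by
      module
    rw [this, e1]
    module
  rw [iota_apply, hν, hν, ← inv_smul_smul₀ (two_ne_zero (α := ℝ)) (S u w), e2]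
  module

end PointwiseAlgebra
end ProjConf

namespace ProjConf

/-! ### Difference tensors of connections, the covariant derivative of a metric, and pull-backs. -/

section Manifold

set_option linter.unusedSectionVars false

variable {n : ℕ} {M : Type*} [TopologicalSpace M] [ChartedSpace (EuclideanSpace ℝ (Fin n)) M]
  [IsManifold (𝓡 n) ∞ M]

/-- The vector field `Y` is differentiable at `x`. -/
abbrev DifferentiableFieldAt (Y : Π x : M, TangentSpace (𝓡 n) x) (x : M) : Prop :=
  MDifferentiableAt (𝓡 n) (𝓡 n).tangent (fun x => (⟨x, Y x⟩ : TangentBundle (𝓡 n) M)) x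

/-- The vector field `Y` is smooth at `x`. -/
abbrev SmoothFieldAt (Y : Π x : M, TangentSpace (𝓡 n) x) (x : M) : Prop :=
  ContMDiffAt (𝓡 n) (𝓡 n).tangent ∞ (fun x => (⟨x, Y x⟩ : TangentBundle (𝓡 n) M)) x

/-- The vector field `Y` is smooth. -/
abbrev SmoothField (Y : Π x : M, TangentSpace (𝓡 n) x) : Prop :=
  ContMDiff (𝓡 n) (𝓡 n).tangent ∞ (fun x => (⟨x, Y x⟩ : TangentBundle (𝓡 n) M))

/-! ### Differences of connections -/

theorem difference_apply (D D' : Connection n M) {Y : Π x : M, TangentSpace (𝓡 n) x} {x : M}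
    (hY : DifferentiableFieldAt Y x) : D.difference D' x (Y x) = D Y x - D' Y x :=
  IsCovariantDerivativeOn.difference_apply _ _ (Set.mem_univ x) hY

theorem exists_mdifferentiableAt_eq {x : M} (u : TangentSpace (𝓡 n) x) :
    ∃ Y : Π x : M, TangentSpace (𝓡 n) x, DifferentiableFieldAt Y x ∧ Y x = u :=
  ⟨FiberBundle.extend (EuclideanSpace ℝ (Fin n)) u,
    FiberBundle.mdifferentiableAt_extend (𝓡 n) (EuclideanSpace ℝ (Fin n)) u,
    FiberBundle.extend_apply_self (F := EuclideanSpace ℝ (Fin n)) u⟩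

theorem difference_eq_of_forall {D D' : Connection n M} {x : M}
    {S : TangentSpace (𝓡 n) x →L[ℝ] TangentSpace (𝓡 n) x →L[ℝ] TangentSpace (𝓡 n) x}
    (h : ∀ Y : Π x : M, TangentSpace (𝓡 n) x, DifferentiableFieldAt Y x → ∀ v,
      D Y x v = D' Y x v + S (Y x) v) : D.difference D' x = S := by
  ext1 u
  obtain ⟨Y, hY, rfl⟩ := exists_mdifferentiableAt_eq u
  rw [difference_apply D D' hY]
  ext1 v
  rw [_root_.sub_apply, h Y hY]
  abel

theorem apply_eq_add_difference (D D' : Connection n M) {Y : Π x : M, TangentSpace (𝓡 n) x}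
    {x : M} (hY : DifferentiableFieldAt Y x) (v : TangentSpace (𝓡 n) x) :
    D Y x v = D' Y x v + D.difference D' x (Y x) v := by
  rw [difference_apply D D' hY, _root_.sub_apply]
  abel

theorem difference_add_difference (D D' D'' : Connection n M) (x : M) :
    D.difference D'' x = D.difference D' x + D'.difference D'' x := by
  refine difference_eq_of_forall fun Y hY v => ?_
  rw [apply_eq_add_difference D D' hY, apply_eq_add_difference D' D'' hY, _root_.add_apply,
    _root_.add_apply]
  abel

theorem difference_swap (D D' : Connection n M) (x : M) :
    D.difference D' x = -D'.difference D x := by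
  refine difference_eq_of_forall fun Y hY v => ?_
  rw [apply_eq_add_difference D' D hY, _root_.neg_apply, _root_.neg_apply]
  abel

theorem addOneForm_difference (D : Connection n M) (S : Π x : M,
    TangentSpace (𝓡 n) x →L[ℝ] TangentSpace (𝓡 n) x →L[ℝ] TangentSpace (𝓡 n) x) (x : M) :
    (D.addOneForm S).difference D x = S x :=
  difference_eq_of_forall fun _ _ _ => rfl

theorem addOneForm_difference_addOneForm (D D' : Connection n M) (S S' : Π x : M,
    TangentSpace (𝓡 n) x →L[ℝ] TangentSpace (𝓡 n) x →L[ℝ] TangentSpace (𝓡 n) x) (x : M) :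
    (D.addOneForm S).difference (D'.addOneForm S') x = D.difference D' x + S x - S' x := by
  refine difference_eq_of_forall fun Y hY v => ?_
  change D Y x v + S x (Y x) v = D' Y x v + S' x (Y x) v + _
  rw [apply_eq_add_difference D D' hY, _root_.sub_apply, _root_.sub_apply, _root_.add_apply,
    _root_.add_apply]
  abel

theorem torsion_eq_zero_iff_difference_symm (D : Connection n M) {D' : Connection n M}
    (h' : D'.torsion = 0) :
    D.torsion = 0 ↔ ∀ x u v, D.difference D' x u v = D.difference D' x v u := by
  rw [CovariantDerivative.torsion_eq_zero_iff] at h' ⊢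
  constructor
  · intro h x u v
    obtain ⟨Y, hY, rfl⟩ := exists_mdifferentiableAt_eq u
    obtain ⟨Z, hZ, rfl⟩ := exists_mdifferentiableAt_eq v
    rw [difference_apply D D' hY, difference_apply D D' hZ, _root_.sub_apply, _root_.sub_apply]
    have e : D Z x (Y x) - D Y x (Z x) = D' Z x (Y x) - D' Y x (Z x) :=
      (h hY hZ).trans (h' hY hZ).symm
    rw [sub_eq_sub_iff_add_eq_add] at e ⊢
    rw [add_comm, ← e, add_comm]
  · intro h X Y x hX hY
    rw [← h' hX hY, apply_eq_add_difference D D' hX, apply_eq_add_difference D D' hY, h]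
    abel

theorem difference_symm {D D' : Connection n M} (h : D.torsion = 0) (h' : D'.torsion = 0) (x : M)
    (u v : TangentSpace (𝓡 n) x) : D.difference D' x u v = D.difference D' x v u :=
  (torsion_eq_zero_iff_difference_symm D h').mp h x u v

theorem torsion_addOneForm {D : Connection n M} (h : D.torsion = 0) {S : Π x : M,
    TangentSpace (𝓡 n) x →L[ℝ] TangentSpace (𝓡 n) x →L[ℝ] TangentSpace (𝓡 n) x}
    (hS : ∀ x u v, S x u v = S x v u) : (D.addOneForm S).torsion = 0 := by
  rw [torsion_eq_zero_iff_difference_symm _ h]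
  intro x u v
  rw [addOneForm_difference, hS]

theorem nablaMetric_eq_sub (g : Metric n M) (D D' : Connection n M) (x : M)
    (u w v : TangentSpace (𝓡 n) x) :
    nablaMetric g D x u w v = nablaMetric g D' x u w v - g.inner x (D.difference D' x u v) w
      - g.inner x u (D.difference D' x w v) := by
  obtain ⟨Y, hY, rfl⟩ := exists_mdifferentiableAt_eq u
  obtain ⟨Z, hZ, rfl⟩ := exists_mdifferentiableAt_eq w
  rw [nablaMetric_apply g D hY hZ, nablaMetric_apply g D' hY hZ, apply_eq_add_difference D D' hY,
    apply_eq_add_difference D D' hZ, map_add, map_add, _root_.add_apply]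
  ring

theorem nablaMetric_of_conformal {g g' : Metric n M} {f : M → ℝ} (hf : MDifferentiable (𝓡 n) 𝓘(ℝ, ℝ) f)
    (h : ∀ x v w, g'.inner x v w = Real.exp (2 * f x) * g.inner x v w) (D : Connection n M) (x : M)
    (u w v : TangentSpace (𝓡 n) x) :
    nablaMetric g' D x u w v = Real.exp (2 * f x) *
      (nablaMetric g D x u w v + 2 * mvfderiv (𝓡 n) f x v * g.inner x u w) := by
  obtain ⟨Y, hY, rfl⟩ := exists_mdifferentiableAt_eq u
  obtain ⟨Z, hZ, rfl⟩ := exists_mdifferentiableAt_eq w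
  have hg : MDifferentiableAt (𝓡 n) 𝓘(ℝ, ℝ) (fun y => g.inner y (Y y) (Z y)) x := by
    let _ : Bundle.RiemannianBundle (TangentSpace (𝓡 n) : M → Type _) := ⟨g.toRiemannianMetric⟩
    exact MDifferentiableAt.inner_bundle (IB := 𝓡 n) (F := EuclideanSpace ℝ (Fin n))
      (E := (TangentSpace (𝓡 n) : M → Type _)) hY hZ
  have hexp : HasMFDerivAt (𝓡 n) 𝓘(ℝ, ℝ) (fun y => Real.exp (2 * f y)) x
      ((2 * Real.exp (2 * f x)) • mfderiv (𝓡 n) 𝓘(ℝ, ℝ) f x) := by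
    have h1 : HasDerivAt (fun t : ℝ => Real.exp (2 * t)) (2 * Real.exp (2 * f x)) (f x) := by
      have := ((hasDerivAt_id (f x)).const_mul 2).exp
      simpa [mul_comm] using this
    have h2 := h1.hasFDerivAt.hasMFDerivAt.comp x (hf x).hasMFDerivAt
    refine h2.congr_mfderiv ?_
    ext v
    change mvfderiv (𝓡 n) f x v * (2 * Real.exp (2 * f x)) =
      2 * Real.exp (2 * f x) * mvfderiv (𝓡 n) f x v
    exact mul_comm _ _
  rw [nablaMetric_apply g' D hY hZ, nablaMetric_apply g D hY hZ, h, h]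
  have e : (fun y => g'.inner y (Y y) (Z y))
      = (fun y => Real.exp (2 * f y)) * fun y => g.inner y (Y y) (Z y) := by
    ext y
    exact h y _ _
  rw [e, mvfderiv_mul hexp.mdifferentiableAt hg]
  have e2 : mvfderiv (𝓡 n) (fun y => Real.exp (2 * f y)) x v
      = 2 * Real.exp (2 * f x) * mvfderiv (𝓡 n) f x v := by
    rw [mvfderiv, hexp.mfderiv]
    rfl
  simp only [_root_.add_apply, _root_.smul_apply, smul_eq_mul, e2]
  ring

/-! ### Pull-backs -/

/-- The differential of a diffeomorphism, as a linear isomorphism. -/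
noncomputable def differential (Φ : M ≃ₘ^∞⟮𝓡 n, 𝓡 n⟯ M) (x : M) :
    TangentSpace (𝓡 n) x ≃L[ℝ] TangentSpace (𝓡 n) (Φ x) :=
  Φ.mfderivToContinuousLinearEquiv (by simp) x

theorem differential_apply (Φ : M ≃ₘ^∞⟮𝓡 n, 𝓡 n⟯ M) (x : M) (v : TangentSpace (𝓡 n) x) :
    differential Φ x v = mfderiv (𝓡 n) (𝓡 n) Φ x v := rfl

theorem differential_pullback_apply (Φ : M ≃ₘ^∞⟮𝓡 n, 𝓡 n⟯ M) (D : Connection n M)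
    (Y : Π x : M, TangentSpace (𝓡 n) x) (x : M) (v : TangentSpace (𝓡 n) x) :
    differential Φ x (pullback Φ D Y x v) = D (pushforward Φ Y) (Φ x) (differential Φ x v) := by
  change differential Φ x ((mfderiv (𝓡 n) (𝓡 n) Φ x).inverse _) = _
  have h : (mfderiv (𝓡 n) (𝓡 n) Φ x) = (differential Φ x : _ →L[ℝ] _) := rfl
  rw [h, ContinuousLinearMap.inverse_equiv]
  exact (differential Φ x).apply_symm_apply _

theorem differential_difference_pullback (Φ : M ≃ₘ^∞⟮𝓡 n, 𝓡 n⟯ M) (D D' : Connection n M)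
    (x : M) (u v : TangentSpace (𝓡 n) x) :
    differential Φ x ((pullback Φ D).difference (pullback Φ D') x u v) =
      D.difference D' (Φ x) (differential Φ x u) (differential Φ x v) := by
  obtain ⟨Y, hY, rfl⟩ := exists_mdifferentiableAt_eq u
  rw [difference_apply _ _ hY, _root_.sub_apply, map_sub, differential_pullback_apply,
    differential_pullback_apply, differential_apply Φ x (Y x), ← pushforward_apply,
    difference_apply _ _ (mdifferentiableAt_pushforward Φ hY), _root_.sub_apply]

/-- The defining formula transports to the push-forwards of the fields, where it follows from
naturality of the Lie bracket under diffeomorphisms. -/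
theorem torsion_pullback (Φ : M ≃ₘ^∞⟮𝓡 n, 𝓡 n⟯ M) {D : Connection n M} (h : D.torsion = 0) :
    (pullback Φ D).torsion = 0 := by
  rw [CovariantDerivative.torsion_eq_zero_iff] at h ⊢
  intro X Y x hX hY
  apply (differential Φ x).injective
  rw [map_sub, differential_pullback_apply, differential_pullback_apply, differential_apply,
    differential_apply, ← pushforward_apply, ← pushforward_apply,
    h (mdifferentiableAt_pushforward Φ hX) (mdifferentiableAt_pushforward Φ hY),
    differential_apply, ← pushforward_apply, pushforward, pushforward, pushforward]
  have hX' : DifferentiableFieldAt X (Φ.symm (Φ x)) := by rwa [Φ.symm_apply_apply]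
  have hY' : DifferentiableFieldAt Y (Φ.symm (Φ x)) := by rwa [Φ.symm_apply_apply]
  have : IsManifold (𝓡 n) (minSmoothness ℝ 2) M := by
    rw [minSmoothness_of_isRCLikeNormedField]
    infer_instance
  refine (VectorField.mpullback_mlieBracket hX' hY' (Φ.symm.contMDiff (Φ x)) ?_).symm
  rw [minSmoothness_of_isRCLikeNormedField]
  norm_cast

end Manifold
end ProjConf

namespace ProjConf

/-! ### Smoothness of tensor fields, tested on global smooth vector fields. -/

section Manifold

set_option linter.unusedSectionVars false

variable {n : ℕ} {M : Type*} [TopologicalSpace M] [ChartedSpace (EuclideanSpace ℝ (Fin n)) M]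
  [IsManifold (𝓡 n) ∞ M]

/-! ### Smooth frames -/

theorem exists_smoothField_eventuallyEq [T2Space M] {Y : Π x : M, TangentSpace (𝓡 n) x} {x₀ : M}
    {U : Set M} (hU : U ∈ nhds x₀) (hY : ContMDiffOn (𝓡 n) (𝓡 n).tangent ∞
      (fun x => (⟨x, Y x⟩ : TangentBundle (𝓡 n) M)) U) :
    ∃ Y' : Π x : M, TangentSpace (𝓡 n) x, SmoothField Y' ∧ ∀ᶠ x in nhds x₀, Y' x = Y x := by
  obtain ⟨f, hf⟩ := (SmoothBumpFunction.nhds_basis_support (I := 𝓡 n)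
    (interior_mem_nhds.mpr hU)).ex_mem
  refine ⟨(f : M → ℝ) • Y, ContMDiffOn.smul_section_of_tsupport f.contMDiff.contMDiffOn
    isOpen_interior hf (hY.mono interior_subset), ?_⟩
  filter_upwards [f.eventuallyEq_one] with x hx
  simp [hx]

/-- The identification of `T_x M` with `ℝⁿ` given by the chart at `x₀`. -/
noncomputable def chartFrame (x₀ : M) {x : M}
    (hx : x ∈ (chartAt (EuclideanSpace ℝ (Fin n)) x₀).source) :
    TangentSpace (𝓡 n) x ≃L[ℝ] EuclideanSpace ℝ (Fin n) :=
  (trivializationAt (EuclideanSpace ℝ (Fin n)) (TangentSpace (𝓡 n)) x₀).continuousLinearEquivAt ℝ x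
    hx

theorem chartFrame_apply (x₀ : M) {x : M}
    (hx : x ∈ (chartAt (EuclideanSpace ℝ (Fin n)) x₀).source) (v : TangentSpace (𝓡 n) x) :
    chartFrame x₀ hx v = mfderiv (𝓡 n) 𝓘(ℝ, EuclideanSpace ℝ (Fin n)) (extChartAt (𝓡 n) x₀) x v := by
  rw [← TangentBundle.continuousLinearMapAt_trivializationAt hx]
  exact congrFun (Bundle.Trivialization.coe_continuousLinearEquivAt_eq _ hx) v

/-- Coordinate fields are multiplied by a bump function, which makes them global smooth fields and
leaves them unchanged near `x₀`. -/
theorem exists_frame [T2Space M] (x₀ : M) :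
    ∃ e : Fin n → Π x : M, TangentSpace (𝓡 n) x, (∀ i, SmoothField (e i)) ∧
      ∀ᶠ x in nhds x₀, ∃ hx : x ∈ (chartAt (EuclideanSpace ℝ (Fin n)) x₀).source,
        ∀ i, e i x = (chartFrame x₀ hx).symm (EuclideanSpace.basisFun (Fin n) ℝ i) := by
  let τ := trivializationAt (EuclideanSpace ℝ (Fin n)) (TangentSpace (𝓡 n) : M → Type _) x₀
  have hτ : τ.baseSet ∈ nhds x₀ :=
    τ.open_baseSet.mem_nhds (FiberBundle.mem_baseSet_trivializationAt' x₀)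
  have h1 := fun i => exists_smoothField_eventuallyEq hτ
    (τ.contMDiffOn_localFrame_baseSet (I := 𝓡 n) ∞ (EuclideanSpace.basisFun (Fin n) ℝ).toBasis i)
  choose e he he' using h1
  refine ⟨e, he, ?_⟩
  filter_upwards [Filter.eventually_all.mpr he', hτ] with x hx hxτ
  refine ⟨hxτ, fun i => ?_⟩
  rw [hx, τ.localFrame_apply_of_mem_baseSet _ hxτ]
  simp [Bundle.Trivialization.basisAt]
  rfl

/-- In the trivialisations, near `x₀`, `L` is the finite sum of the coordinate projections tensored
with the values of `L` on a smooth frame, so smoothness of those values suffices. -/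
theorem contMDiffAt_hom_of_forall [T2Space M] {F : Type*} [NormedAddCommGroup F] [NormedSpace ℝ F]
    {V : M → Type*} [TopologicalSpace (Bundle.TotalSpace F V)] [∀ x, AddCommGroup (V x)]
    [∀ x, Module ℝ (V x)] [∀ x, TopologicalSpace (V x)] [∀ x, IsTopologicalAddGroup (V x)]
    [∀ x, ContinuousSMul ℝ (V x)] [FiberBundle F V] [VectorBundle ℝ F V]
    {L : Π x : M, TangentSpace (𝓡 n) x →L[ℝ] V x} {x₀ : M}
    (h : ∀ Y : Π x : M, TangentSpace (𝓡 n) x, SmoothField Y →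
      ContMDiffAt (𝓡 n) ((𝓡 n).prod 𝓘(ℝ, F)) ∞
        (fun x => Bundle.TotalSpace.mk' F x (L x (Y x))) x₀) :
    ContMDiffAt (𝓡 n) ((𝓡 n).prod 𝓘(ℝ, EuclideanSpace ℝ (Fin n) →L[ℝ] F)) ∞
      (fun x => Bundle.TotalSpace.mk' (EuclideanSpace ℝ (Fin n) →L[ℝ] F)
        (E := fun x => TangentSpace (𝓡 n) x →L[ℝ] V x) x (L x)) x₀ := by
  rw [contMDiffAt_hom_bundle]
  refine ⟨contMDiffAt_id, ?_⟩
  obtain ⟨e, he, hbase⟩ := exists_frame (n := n) x₀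
  have h1 : ContMDiffAt (𝓡 n) 𝓘(ℝ, EuclideanSpace ℝ (Fin n) →L[ℝ] F) ∞
      (fun x => ∑ i, (EuclideanSpace.proj i : EuclideanSpace ℝ (Fin n) →L[ℝ] ℝ).smulRight
        (trivializationAt F V x₀ ⟨x, L x (e i x)⟩).2) x₀ := by
    refine ContMDiffAt.sum fun i _ => ?_
    have h2 := (Bundle.contMDiffAt_section x₀).mp (h (e i) (he i))
    exact ((ContinuousLinearMap.smulRightL ℝ (EuclideanSpace ℝ (Fin n)) F
      (EuclideanSpace.proj i)).contMDiff.contMDiffAt).comp x₀ h2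
  refine h1.congr_of_eventuallyEq ?_
  have hV : (trivializationAt F V x₀).baseSet ∈ nhds x₀ :=
    (trivializationAt F V x₀).open_baseSet.mem_nhds (FiberBundle.mem_baseSet_trivializationAt' x₀)
  filter_upwards [hbase, hV] with x hx hxV
  obtain ⟨hxc, hx⟩ := hx
  refine ContinuousLinearMap.coe_injective
    ((EuclideanSpace.basisFun (Fin n) ℝ).toBasis.ext fun j => ?_)
  rw [ContinuousLinearMap.inCoordinates_eq hxc hxV]
  have h3 : ∀ i, (EuclideanSpace.proj i : EuclideanSpace ℝ (Fin n) →L[ℝ] ℝ)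
      (EuclideanSpace.basisFun (Fin n) ℝ j) = if i = j then 1 else 0 := by
    intro i
    simp [EuclideanSpace.basisFun_apply]
  simp only [OrthonormalBasis.coe_toBasis, ContinuousLinearMap.coe_coe, _root_.sum_apply,
    ContinuousLinearMap.smulRight_apply, h3, ite_smul, one_smul,
    zero_smul, Finset.sum_ite_eq',
    Finset.mem_univ, if_true, hx]
  rfl

/-! ### Smoothness of derived fields -/

theorem contMDiff_metric_apply (g : Metric n M) {Y Z : Π x : M, TangentSpace (𝓡 n) x} {x : M}
    (hY : SmoothFieldAt Y x) (hZ : SmoothFieldAt Z x) :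
    ContMDiffAt (𝓡 n) 𝓘(ℝ, ℝ) ∞ (fun y => g.inner y (Y y) (Z y)) x := by
  let _ : Bundle.RiemannianBundle (TangentSpace (𝓡 n) : M → Type _) := ⟨g.toRiemannianMetric⟩
  exact ContMDiffAt.inner_bundle (IB := 𝓡 n) (F := EuclideanSpace ℝ (Fin n))
    (E := (TangentSpace (𝓡 n) : M → Type _)) hY hZ

theorem contMDiff_mvfderiv_apply {f : M → ℝ} (hf : ContMDiff (𝓡 n) 𝓘(ℝ, ℝ) ∞ f)
    {V : Π x : M, TangentSpace (𝓡 n) x} (hV : SmoothField V) :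
    ContMDiff (𝓡 n) 𝓘(ℝ, ℝ) ∞ (fun x => mvfderiv (𝓡 n) f x (V x)) := by
  have h1 := (hf.contMDiff_tangentMap (m := ∞) (by norm_cast)).comp hV
  intro x
  exact ((Bundle.contMDiffAt_totalSpace).mp (h1 x)).2.congr_of_eventuallyEq
    (Filter.Eventually.of_forall fun y => by simp [tangentMap]; rfl)

theorem contMDiffAt_det {ι : Type*} [Fintype ι] [DecidableEq ι] {A : M → Matrix ι ι ℝ} {x : M}
    (hA : ∀ i j, ContMDiffAt (𝓡 n) 𝓘(ℝ, ℝ) ∞ (fun y => A y i j) x) :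
    ContMDiffAt (𝓡 n) 𝓘(ℝ, ℝ) ∞ (fun y => (A y).det) x := by
  simp only [Matrix.det_apply']
  refine ContMDiffAt.sum fun σ _ => ?_
  exact contMDiffAt_const.mul (contMDiffAt_finsetProd fun i _ => hA _ _)

/-- By Cramer's rule the entries of the inverse are quotients of determinants of smooth entries. -/
theorem contMDiffAt_inv_matrix {ι : Type*} [Fintype ι] [DecidableEq ι] {A : M → Matrix ι ι ℝ}
    {x : M} (hA : ∀ i j, ContMDiffAt (𝓡 n) 𝓘(ℝ, ℝ) ∞ (fun y => A y i j) x)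
    (h0 : (A x).det ≠ 0) (i j : ι) :
    ContMDiffAt (𝓡 n) 𝓘(ℝ, ℝ) ∞ (fun y => (A y)⁻¹ i j) x := by
  simp only [Matrix.inv_def, Matrix.smul_apply, Matrix.adjugate_apply, Ring.inverse_eq_inv',
    smul_eq_mul]
  refine ((contMDiffAt_det hA).inv₀ h0).mul (contMDiffAt_det fun k l => ?_)
  by_cases hk : k = j
  · subst hk
    simpa using contMDiffAt_const
  · simpa [Matrix.updateRow_ne hk] using hA k l

theorem exists_frame_gram [T2Space M] (g : Metric n M) (x₀ : M) :
    ∃ (e : Fin n → Π x : M, TangentSpace (𝓡 n) x) (G : Fin n → Fin n → M → ℝ),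
      (∀ i, SmoothField (e i)) ∧ (∀ i j, ContMDiffAt (𝓡 n) 𝓘(ℝ, ℝ) ∞ (G i j) x₀) ∧
      ∀ᶠ x in nhds x₀, ∃ b : Module.Basis (Fin n) ℝ (TangentSpace (𝓡 n) x),
        (∀ i, e i x = b i) ∧ ∀ i j, G i j x = (gram b (g.inner x))⁻¹ i j := by
  obtain ⟨e, he, hbase⟩ := exists_frame (n := n) x₀
  have hbase' : ∀ᶠ x in nhds x₀, ∃ b : Module.Basis (Fin n) ℝ (TangentSpace (𝓡 n) x),
      ∀ i, e i x = b i := by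
    filter_upwards [hbase] with x hx
    obtain ⟨hxc, hx⟩ := hx
    exact ⟨(EuclideanSpace.basisFun (Fin n) ℝ).toBasis.map (chartFrame x₀ hxc).symm.toLinearEquiv,
      fun i => by simpa using hx i⟩
  have hG : ∀ {x : M} {b : Module.Basis (Fin n) ℝ (TangentSpace (𝓡 n) x)},
      (∀ i, e i x = b i) →
      (Matrix.of fun k l => g.inner x (e k x) (e l x)) = gram b (g.inner x) := by
    intro x b hb
    ext k l
    simp only [gram, Matrix.of_apply, hb]
  refine ⟨e, fun i j x => (Matrix.of fun k l => g.inner x (e k x) (e l x))⁻¹ i j, he,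
    fun i j => ?_, ?_⟩
  · refine contMDiffAt_inv_matrix (fun k l => ?_) ?_ i j
    · exact contMDiff_metric_apply g (he k x₀) (he l x₀)
    · obtain ⟨b, hb⟩ := hbase'.self_of_nhds
      rw [hG hb]
      exact (isUnit_det_gram b (g.pos x₀)).ne_zero
  · filter_upwards [hbase'] with x hx
    obtain ⟨b, hb⟩ := hx
    exact ⟨b, hb, fun i j => by rw [hG hb]⟩

/-- Near `x₀`, `Z` is recovered from its inner products with a smooth frame by raising the index
with the smooth inverse Gram matrix. -/
theorem smoothFieldAt_of_inner [T2Space M] (g : Metric n M) {Z : Π x : M, TangentSpace (𝓡 n) x}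
    {x₀ : M} (h : ∀ W : Π x : M, TangentSpace (𝓡 n) x, SmoothField W →
      ContMDiffAt (𝓡 n) 𝓘(ℝ, ℝ) ∞ (fun x => g.inner x (Z x) (W x)) x₀) : SmoothFieldAt Z x₀ := by
  obtain ⟨e, G, he, hG, hb⟩ := exists_frame_gram g x₀
  have h1 : SmoothFieldAt (fun x => ∑ i, ∑ j, (G i j x * g.inner x (Z x) (e j x)) • e i x) x₀ :=
    ContMDiffAt.sum_section fun i _ => ContMDiffAt.sum_section fun j _ =>
      ContMDiffAt.smul_section ((hG i j).mul (h _ (he j))) (he i x₀)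
  refine h1.congr_of_eventuallyEq ?_
  filter_upwards [hb] with x hx
  obtain ⟨b, hbe, hbG⟩ := hx
  have h2 := eq_sum_gram_inv b (g.pos x) (Z x)
  simp only [← hbG, ← hbe, g.symm x _ (Z x)] at h2
  exact congrArg _ h2

theorem finrank_tangentSpace (x : M) : Module.finrank ℝ (TangentSpace (𝓡 n) x) = n :=
  finrank_euclideanSpace_fin

/-- A tensor field of type `(1, 2)` is smooth. -/
def SmoothTensor (K : Π x : M, TangentSpace (𝓡 n) x →L[ℝ] TangentSpace (𝓡 n) x →L[ℝ]
    TangentSpace (𝓡 n) x) : Prop :=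
  ∀ Y Z : Π x : M, TangentSpace (𝓡 n) x, SmoothField Y → SmoothField Z →
    SmoothField fun x => K x (Y x) (Z x)

/-- A `1`-form is smooth. -/
def SmoothForm (μ : Π x : M, TangentSpace (𝓡 n) x →L[ℝ] ℝ) : Prop :=
  ∀ Y : Π x : M, TangentSpace (𝓡 n) x, SmoothField Y →
    ContMDiff (𝓡 n) 𝓘(ℝ, ℝ) ∞ fun x => μ x (Y x)

section Tensors

variable {K L : Π x : M, TangentSpace (𝓡 n) x →L[ℝ] TangentSpace (𝓡 n) x →L[ℝ]
    TangentSpace (𝓡 n) x}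

theorem SmoothTensor.sub (hK : SmoothTensor K) (hL : SmoothTensor L) :
    SmoothTensor fun x => K x - L x :=
  fun Y Z hY hZ => (hK Y Z hY hZ).sub_section (hL Y Z hY hZ)

theorem SmoothTensor.const_smul (c : ℝ) (hK : SmoothTensor K) : SmoothTensor fun x => c • K x :=
  fun Y Z hY hZ => (hK Y Z hY hZ).const_smul_section (a := c)

theorem SmoothForm.iota {μ : Π x : M, TangentSpace (𝓡 n) x →L[ℝ] ℝ} (hμ : SmoothForm μ) :
    SmoothTensor fun x => iota (μ x) :=
  fun _ _ hY hZ => ((hμ _ hY).smul_section hZ).add_section ((hμ _ hZ).smul_section hY)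

theorem smoothTensor_tensorVec (g : Metric n M) {X : Π x : M, TangentSpace (𝓡 n) x}
    (hX : SmoothField X) : SmoothTensor fun x => tensorVec (g.inner x) (X x) :=
  fun _ _ hY hZ => ContMDiff.smul_section
    (fun x => contMDiff_metric_apply g (hY x) (hZ x)) hX

theorem smoothForm_inner (g : Metric n M) {X : Π x : M, TangentSpace (𝓡 n) x}
    (hX : SmoothField X) : SmoothForm fun x => g.inner x (X x) :=
  fun _ hY x => contMDiff_metric_apply g (hX x) (hY x)

/-- The metric is auxiliary: it expresses the trace as `g^{ij} g(e_j, K(e_i, Y))`, whose terms are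
visibly smooth. -/
theorem SmoothTensor.tr [T2Space M] (g : Metric n M) (hK : SmoothTensor K) :
    SmoothForm fun x => tr (K x) := by
  intro Y hY x₀
  obtain ⟨e, G, he, hG, hb⟩ := exists_frame_gram g x₀
  have h1 : ContMDiffAt (𝓡 n) 𝓘(ℝ, ℝ) ∞
      (fun x => ∑ i, ∑ j, G i j x * g.inner x (e j x) (K x (e i x) (Y x))) x₀ :=
    ContMDiffAt.sum fun i _ => ContMDiffAt.sum fun j _ =>
      (hG i j).mul (contMDiff_metric_apply g (he j x₀) (hK _ _ (he i) hY x₀))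
  refine h1.congr_of_eventuallyEq ?_
  filter_upwards [hb] with x hx
  obtain ⟨b, hbe, hbG⟩ := hx
  rw [tr_apply, LinearMap.trace_eq_matrix_trace ℝ b, Matrix.trace]
  refine Finset.sum_congr rfl fun i _ => ?_
  rw [Matrix.diag_apply, LinearMap.toMatrix_apply, repr_eq_sum_gram_inv b (g.pos x)]
  simp only [← hbG, ← hbe]
  rfl

theorem SmoothTensor.traceFree [T2Space M] (g : Metric n M) (hK : SmoothTensor K) :
    SmoothTensor fun x => traceFree (K x) := by
  simp only [ProjConf.traceFree, finrank_tangentSpace]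
  exact hK.sub ((hK.tr g).iota.const_smul _)

theorem SmoothTensor.contract [T2Space M] (g : Metric n M) (hK : SmoothTensor K) :
    SmoothField fun x => contract (tangentBasis x) (g.inner x) (K x) := by
  intro x₀
  obtain ⟨e, G, he, hG, hb⟩ := exists_frame_gram g x₀
  have h1 : SmoothFieldAt (fun x => ∑ i, ∑ j, G i j x • K x (e i x) (e j x)) x₀ :=
    ContMDiffAt.sum_section fun i _ => ContMDiffAt.sum_section fun j _ =>
      ContMDiffAt.smul_section (hG i j) (hK _ _ (he i) (he j) x₀)
  refine h1.congr_of_eventuallyEq ?_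
  filter_upwards [hb] with x hx
  obtain ⟨b, hbe, hbG⟩ := hx
  rw [contract_eq_of_basis _ b (g.symm x) (g.pos x)]
  simp only [ProjConf.contract, ← hbG, ← hbe]

end Tensors

/-! ### Smooth connections -/

theorem IsTorsionFree.smoothField_apply {D : Connection n M} (hD : IsTorsionFree D)
    {Y Z : Π x : M, TangentSpace (𝓡 n) x} (hY : SmoothField Y) (hZ : SmoothField Z) :
    SmoothField fun x => D Y x (Z x) := by
  have h := contMDiffOn_univ.mp (hD.2.contMDiff.contMDiff (σ := Y)
    (contMDiffOn_univ.mpr (by simpa using hY)))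
  exact ContMDiff.clm_bundle_apply (b := fun x : M => x) h hZ

theorem IsTorsionFree.addOneForm [T2Space M] {D : Connection n M} (hD : IsTorsionFree D)
    {S : Π x : M, TangentSpace (𝓡 n) x →L[ℝ] TangentSpace (𝓡 n) x →L[ℝ] TangentSpace (𝓡 n) x}
    (hS : SmoothTensor S) (hs : ∀ x u v, S x u v = S x v u) : IsTorsionFree (D.addOneForm S) := by
  refine ⟨torsion_addOneForm hD.1 hs, ⟨⟨fun {Y} hY => contMDiffOn_univ.mpr fun x₀ => ?_⟩⟩⟩
  have hY' : SmoothField Y := by simpa using contMDiffOn_univ.mp hY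
  exact contMDiffAt_hom_of_forall fun Z hZ =>
    ((hD.smoothField_apply hY' hZ).add_section (hS Y Z hY' hZ)) x₀

theorem isLeviCivita_leviCivita (g : Metric n M) (h : Nonempty (TorsionFreeConnection n M)) :
    IsLeviCivita g (leviCivita g h) :=
  (exists_isLeviCivita g h).choose_spec

/-- The Levi-Civita connection is obtained by choice and carries no smoothness with it. The Koszul
formula expresses the difference tensor through `∇g` for the smooth representative `∇`, and `∇g` is
smooth on smooth fields. -/
theorem smoothTensor_differenceLC [T2Space M] (p : ProjectiveStructure n M) (g : Metric n M) :
    SmoothTensor (differenceLC p g) := by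
  intro Y V hY hV x₀
  have hLC := isLeviCivita_leviCivita g ⟨p.rep⟩
  refine smoothFieldAt_of_inner g fun W hW => ?_
  have hQ : ∀ Y V W : Π x : M, TangentSpace (𝓡 n) x, SmoothField Y → SmoothField V →
      SmoothField W → ContMDiff (𝓡 n) 𝓘(ℝ, ℝ) ∞
        fun x => nablaMetric g p.rep.1 x (Y x) (V x) (W x) := by
    intro Y V W hY hV hW
    have h1 : (fun x => nablaMetric g p.rep.1 x (Y x) (V x) (W x)) = fun x =>
        mvfderiv (𝓡 n) (fun y => g.inner y (Y y) (V y)) x (W x)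
          - g.inner x (p.rep.1 Y x (W x)) (V x) - g.inner x (Y x) (p.rep.1 V x (W x)) := by
      ext x
      exact nablaMetric_apply g _ (hY.mdifferentiable (by simp) x)
        (hV.mdifferentiable (by simp) x) _
    rw [h1]
    exact ((contMDiff_mvfderiv_apply (fun x => contMDiff_metric_apply g (hY x) (hV x)) hW).sub
      fun x => contMDiff_metric_apply g (p.rep.2.smoothField_apply hY hW x) (hV x)).sub
      fun x => contMDiff_metric_apply g (hY x) (p.rep.2.smoothField_apply hV hW x)
  have h2 : (fun x => g.inner x (differenceLC p g x (Y x) (V x)) (W x)) = fun x =>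
      -2⁻¹ * (nablaMetric g p.rep.1 x (Y x) (W x) (V x) + nablaMetric g p.rep.1 x (V x) (W x) (Y x)
        - nablaMetric g p.rep.1 x (Y x) (V x) (W x)) := by
    ext x
    have e := fun u w v => nablaMetric_eq_sub g p.rep.1 (leviCivita g ⟨p.rep⟩) x u w v
    have e0 : nablaMetric g (leviCivita g ⟨p.rep⟩) x = 0 := hLC.2 x
    have hs := difference_symm p.rep.2.1 hLC.1 x
    rw [e, e, e, e0, differenceLC]
    change _ = -2⁻¹ * ((0 - _ - _) + (0 - _ - _) - (0 - _ - _))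
    simp only [g.symm x (Y x), g.symm x (V x)]
    rw [hs (V x) (Y x), hs (W x) (V x), hs (W x) (Y x)]
    ring
  rw [h2]
  exact contMDiffAt_const.mul (((hQ Y W V hY hW hV x₀).add (hQ V W Y hV hW hY x₀)).sub
    (hQ Y V W hY hV hW x₀))

theorem smoothField_vectorX [T2Space M] (p : ProjectiveStructure n M) (g : Metric n M) :
    SmoothField (vectorX p g) :=
  (((smoothTensor_differenceLC p g).traceFree g).contract g).const_smul_section
    (a := (((n : ℝ) + 1) / (((n : ℝ) + 2) * ((n : ℝ) - 1))))

theorem smoothTensor_tensorA [T2Space M] (p : ProjectiveStructure n M) (g : Metric n M) :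
    SmoothTensor (tensorA p g) :=
  ((smoothTensor_differenceLC p g).sub
    (smoothTensor_tensorVec g (smoothField_vectorX p g))).traceFree g

/-! ### Pull-back of metrics and of their covariant derivatives. -/

theorem SmoothField.pushforward {Y : Π x : M, TangentSpace (𝓡 n) x} (hY : SmoothField Y)
    (Φ : M ≃ₘ^∞⟮𝓡 n, 𝓡 n⟯ M) : SmoothField (pushforward Φ Y) :=
  ContMDiff.mpullback_vectorField (n := ∞) hY Φ.symm.contMDiff (isInvertible_mfderiv Φ.symm)
    (by norm_cast)

/-- The pull-back of a Riemannian metric under a diffeomorphism. -/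
noncomputable def pullbackMetric [T2Space M] (Φ : M ≃ₘ^∞⟮𝓡 n, 𝓡 n⟯ M) (g : Metric n M) :
    Metric n M where
  inner x := pullbackForm (differential Φ x) (g.inner (Φ x))
  symm x v w := g.symm _ _ _
  pos x v hv := g.pos _ _ fun h => hv ((differential Φ x).injective (h.trans (map_zero _).symm))
  isVonNBounded x := by
    have h := (g.isVonNBounded (Φ x)).image
      (differential Φ x).symm.toContinuousLinearMap
    have hsub : {v : TangentSpace (𝓡 n) x |
        pullbackForm (differential Φ x) (g.inner (Φ x)) v v < 1} ⊆
        (differential Φ x).symm.toContinuousLinearMap '' {v | g.inner (Φ x) v v < 1} :=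
      fun v hv => ⟨differential Φ x v, hv, (differential Φ x).symm_apply_apply v⟩
    exact Bornology.IsVonNBounded.subset hsub h
  contMDiff x₀ := by
    refine contMDiffAt_hom_of_forall fun Y hY => contMDiffAt_hom_of_forall fun Z hZ => ?_
    rw [Bundle.contMDiffAt_section]
    have h := (contMDiff_metric_apply g (hY.pushforward Φ (Φ x₀)) (hZ.pushforward Φ (Φ x₀))).comp x₀
      (Φ.contMDiff x₀)
    refine h.congr_of_eventuallyEq (Filter.Eventually.of_forall fun x => ?_)
    change g.inner (Φ x) (differential Φ x (Y x)) (differential Φ x (Z x)) =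
      g.inner (Φ x) (pushforward Φ Y (Φ x)) (pushforward Φ Z (Φ x))
    rw [pushforward_apply, pushforward_apply]
    rfl

theorem pullbackMetric_apply [T2Space M] (Φ : M ≃ₘ^∞⟮𝓡 n, 𝓡 n⟯ M) (g : Metric n M) (x : M)
    (u v : TangentSpace (𝓡 n) x) : (pullbackMetric Φ g).inner x u v =
      g.inner (Φ x) (differential Φ x u) (differential Φ x v) := rfl

theorem nablaMetric_pullback [T2Space M] (Φ : M ≃ₘ^∞⟮𝓡 n, 𝓡 n⟯ M) (g : Metric n M)
    (D : Connection n M) (x : M) (u w v : TangentSpace (𝓡 n) x) :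
    nablaMetric (pullbackMetric Φ g) (pullback Φ D) x u w v =
      nablaMetric g D (Φ x) (differential Φ x u) (differential Φ x w) (differential Φ x v) := by
  obtain ⟨Y, hY, rfl⟩ := exists_mdifferentiableAt_eq u
  obtain ⟨Z, hZ, rfl⟩ := exists_mdifferentiableAt_eq w
  have hY' := mdifferentiableAt_pushforward Φ hY
  have hZ' := mdifferentiableAt_pushforward Φ hZ
  have eY := pushforward_apply Φ Y
  have eZ := pushforward_apply Φ Z
  simp only [← differential_apply] at eY eZ
  rw [nablaMetric_apply _ _ hY hZ, ← eY, ← eZ, nablaMetric_apply g D hY' hZ',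
    pullbackMetric_apply, pullbackMetric_apply, differential_pullback_apply,
    differential_pullback_apply, ← eY, ← eZ]
  congr 2
  have hd : MDifferentiableAt (𝓡 n) 𝓘(ℝ, ℝ)
      (fun y => g.inner y (pushforward Φ Y y) (pushforward Φ Z y)) (Φ x) := by
    let _ : Bundle.RiemannianBundle (TangentSpace (𝓡 n) : M → Type _) := ⟨g.toRiemannianMetric⟩
    exact MDifferentiableAt.inner_bundle (IB := 𝓡 n) (F := EuclideanSpace ℝ (Fin n))
      (E := (TangentSpace (𝓡 n) : M → Type _)) hY' hZ'
  have e : (fun y => (pullbackMetric Φ g).inner y (Y y) (Z y)) =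
      (fun y => g.inner y (pushforward Φ Y y) (pushforward Φ Z y)) ∘ Φ := by
    ext y
    rw [pullbackMetric_apply, ← eY, ← eZ]
    rfl
  rw [e]
  exact congrArg (fun L => L v) (mfderiv_comp x hd (Φ.mdifferentiable (by simp) x))

end Manifold
end ProjConf

namespace ProjConf

/-! ### Smooth solutions of second-order equations and local left inverses of curves. -/

section SecondOrderEquation

variable {E : Type*} [NormedAddCommGroup E] [NormedSpace ℝ E]

/-- Bootstrapping: if the solution is `C^k`, then its derivative `f ∘ α` is `C^k`, so the solution
is `C^{k+1}`. -/
theorem contDiffOn_of_hasDerivAt {f : E → E} {W : Set E} (hf : ContDiffOn ℝ ∞ f W) {α : ℝ → E}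
    {s : Set ℝ} (hs : IsOpen s) (hα : ∀ t ∈ s, HasDerivAt α (f (α t)) t) (hW : Set.MapsTo α s W) :
    ContDiffOn ℝ ∞ α s := by
  refine contDiffOn_infty.mpr fun k => ?_
  induction k with
  | zero =>
    exact contDiffOn_zero.mpr fun t ht => (hα t ht).continuousAt.continuousWithinAt
  | succ k ih =>
    have h : ((k + 1 : ℕ) : WithTop ℕ∞) = (k : WithTop ℕ∞) + 1 := by norm_cast
    rw [h, contDiffOn_succ_iff_deriv_of_isOpen hs]
    refine ⟨fun t ht => (hα t ht).differentiableAt.differentiableWithinAt, by simp, ?_⟩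
    exact ((contDiffOn_infty.mp hf k).comp ih hW).congr fun t ht => (hα t ht).deriv

/-- This is Picard–Lindelöf for the first-order system `(c, u)' = (u, F(c, u))`, on an interval
shrunk so that the solution stays in `W`. -/
theorem exists_solution_second_order [CompleteSpace E] {W : Set (E × E)} (hW : IsOpen W)
    {F : E × E → E} (hF : ContDiffOn ℝ ∞ F W) {y u : E} (h0 : (y, u) ∈ W) :
    ∃ (c : ℝ → E) (ε : ℝ), 0 < ε ∧ c 0 = y ∧ deriv c 0 = u ∧ ContDiffOn ℝ ∞ c (Set.Ioo (-ε) ε) ∧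
      ∀ t ∈ Set.Ioo (-ε) ε, (c t, deriv c t) ∈ W ∧ deriv (deriv c) t = F (c t, deriv c t) := by
  have hf : ContDiffOn ℝ ∞ (fun p : E × E => (p.2, F p)) W := contDiffOn_snd.prodMk hF
  obtain ⟨α, hα0, ε, hε, hα⟩ := ContDiffAt.exists_forall_mem_closedBall_exists_eq_forall_mem_Ioo_hasDerivAt₀
    ((hf.contDiffAt (hW.mem_nhds h0)).of_le (by norm_cast)) 0
  rw [zero_sub, zero_add] at hα
  have hc : ContinuousAt α 0 := (hα 0 ⟨by linarith, hε⟩).continuousAt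
  have hm : α ⁻¹' W ∈ nhds (0 : ℝ) := hc.preimage_mem_nhds (hW.mem_nhds (by rwa [hα0]))
  obtain ⟨δ, hδ, hδW⟩ := Metric.mem_nhds_iff.mp hm
  rw [Real.ball_eq_Ioo, zero_sub, zero_add] at hδW
  have hsub1 : Set.Ioo (-min ε δ) (min ε δ) ⊆ Set.Ioo (-ε) ε :=
    Set.Ioo_subset_Ioo (neg_le_neg (min_le_left _ _)) (min_le_left _ _)
  have hsub2 : Set.Ioo (-min ε δ) (min ε δ) ⊆ Set.Ioo (-δ) δ :=
    Set.Ioo_subset_Ioo (neg_le_neg (min_le_right _ _)) (min_le_right _ _)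
  have hd : ∀ t ∈ Set.Ioo (-min ε δ) (min ε δ), HasDerivAt (fun t => (α t).1) (α t).2 t :=
    fun t ht => (hα t (hsub1 ht)).fst
  have hd2 : ∀ t ∈ Set.Ioo (-min ε δ) (min ε δ), HasDerivAt (fun t => (α t).2) (F (α t)) t :=
    fun t ht => (hα t (hsub1 ht)).snd
  have hpos : 0 < min ε δ := lt_min hε hδ
  refine ⟨fun t => (α t).1, min ε δ, hpos, by simp [hα0], ?_, ?_, fun t ht => ?_⟩
  · rw [(hd 0 ⟨by linarith, hpos⟩).deriv, hα0]
  · exact (contDiffOn_of_hasDerivAt hf isOpen_Ioo (fun t ht => hα t (hsub1 ht))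
      (fun t ht => hδW (hsub2 ht))).fst
  · rw [(hd t ht).deriv]
    refine ⟨hδW (hsub2 ht), ?_⟩
    have h : deriv (fun t => (α t).1) =ᶠ[nhds t] fun t => (α t).2 := by
      filter_upwards [isOpen_Ioo.mem_nhds ht] with s hs
      exact (hd s hs).deriv
    rw [h.deriv_eq, (hd2 t ht).deriv]

/-- A curve with non-zero velocity at time `0` has a smooth left inverse near its value there. -/
theorem exists_smooth_left_inverse {E : Type*} [NormedAddCommGroup E] [InnerProductSpace ℝ E]
    {c : ℝ → E} {ε : ℝ} (hε : 0 < ε) (hc : ContDiffOn ℝ ∞ c (Set.Ioo (-ε) ε))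
    (h0 : deriv c 0 ≠ 0) :
    ∃ (θ : E → ℝ) (U : Set E), IsOpen U ∧ c 0 ∈ U ∧ ContDiffOn ℝ ∞ θ U ∧
      Set.MapsTo θ U (Set.Ioo (-ε) ε) ∧ ∀ᶠ s in nhds 0, θ (c s) = s := by
  -- Projecting to the initial velocity gives a real function `h = ℓ ∘ c` with `h'(0) = |c'(0)|² ≠
  -- 0`; the left inverse is a local inverse of `h` composed with `ℓ`.
  let ℓ : E →L[ℝ] ℝ := innerSL ℝ (deriv c 0)
  have hmem0 : (0 : ℝ) ∈ Set.Ioo (-ε) ε := ⟨by linarith, hε⟩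
  have hcd : ∀ t ∈ Set.Ioo (-ε) ε, ContDiffAt ℝ ∞ c t :=
    fun t ht => hc.contDiffAt (isOpen_Ioo.mem_nhds ht)
  let h : ℝ → ℝ := fun t => ℓ (c t)
  have hh : ∀ t ∈ Set.Ioo (-ε) ε, ContDiffAt ℝ ∞ h t :=
    fun t ht => ℓ.contDiff.contDiffAt.comp t (hcd t ht)
  have hhd : ∀ t ∈ Set.Ioo (-ε) ε, HasDerivAt h (ℓ (deriv c t)) t := fun t ht =>
    ℓ.hasFDerivAt.comp_hasDerivAt t ((hcd t ht).differentiableAt (by simp)).hasDerivAt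
  have hne : ℓ (deriv c 0) ≠ 0 := by
    simpa [ℓ] using h0
  have hst : HasStrictDerivAt h (ℓ (deriv c 0)) 0 := by
    have := (hh 0 hmem0).hasStrictDerivAt (by simp)
    rwa [(hhd 0 hmem0).deriv] at this
  let e := (hst.hasStrictFDerivAt_equiv hne).toOpenPartialHomeomorph h
  have he : (0 : ℝ) ∈ e.source := (hst.hasStrictFDerivAt_equiv hne).mem_toOpenPartialHomeomorph_source
  have hcont : ContinuousOn (fun t => ℓ (deriv c t)) (Set.Ioo (-ε) ε) :=
    ℓ.continuous.comp_continuousOn (hc.continuousOn_deriv_of_isOpen isOpen_Ioo (by simp))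
  -- On `s` the derivative of `h` does not vanish, so the local inverse is smooth at every point of
  -- its target that it sends into `s`.
  let s : Set ℝ := Set.Ioo (-ε) ε ∩ (fun t => ℓ (deriv c t)) ⁻¹' {0}ᶜ
  have hs : IsOpen s := hcont.isOpen_inter_preimage isOpen_Ioo isOpen_compl_singleton
  let T : Set ℝ := e.target ∩ e.symm ⁻¹' s
  have hT : IsOpen T := e.isOpen_inter_preimage_symm hs
  have hθ : ContDiffOn ℝ ∞ e.symm T := by
    intro a ha
    exact (e.contDiffAt_symm_deriv ha.2.2 ha.1 (hhd _ ha.2.1) (hh _ ha.2.1)).contDiffWithinAt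
  have hev : ∀ᶠ t in nhds (0 : ℝ), e.symm (h t) = t := by
    filter_upwards [e.open_source.mem_nhds he] with t ht
    exact e.left_inv ht
  refine ⟨fun y => e.symm (ℓ y), ℓ ⁻¹' T, hT.preimage ℓ.continuous, ?_,
    hθ.comp ℓ.contDiff.contDiffOn (Set.mapsTo_preimage _ _), fun y hy => hy.2.1, hev⟩
  refine ⟨e.map_source he, ?_⟩
  have : e.symm (ℓ (c 0)) = 0 := e.left_inv he
  change e.symm (ℓ (c 0)) ∈ s
  rw [this]
  exact ⟨hmem0, hne⟩

end SecondOrderEquation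
end ProjConf

namespace ProjConf

/-! ### Connections and geodesic equations in a chart. -/

section Manifold

set_option linter.unusedSectionVars false

variable {n : ℕ} {M : Type*} [TopologicalSpace M] [ChartedSpace (EuclideanSpace ℝ (Fin n)) M]
  [IsManifold (𝓡 n) ∞ M]

/-! ### Geodesics in a chart -/

/-- The differential of the chart at `x₀`. -/
noncomputable def chartCoord (x₀ x : M) : TangentSpace (𝓡 n) x →L[ℝ] EuclideanSpace ℝ (Fin n) :=
  mvfderiv (𝓡 n) (extChartAt (𝓡 n) x₀) x

theorem chartCoord_apply {x₀ x : M} (hx : x ∈ (chartAt (EuclideanSpace ℝ (Fin n)) x₀).source)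
    (v : TangentSpace (𝓡 n) x) : chartCoord x₀ x v = chartFrame x₀ hx v :=
  (chartFrame_apply x₀ hx v).symm

theorem contMDiffAt_chartCoord {Y : Π x : M, TangentSpace (𝓡 n) x} {x₀ x : M}
    (hx : x ∈ (chartAt (EuclideanSpace ℝ (Fin n)) x₀).source) (hY : SmoothFieldAt Y x) :
    ContMDiffAt (𝓡 n) 𝓘(ℝ, EuclideanSpace ℝ (Fin n)) ∞ (fun x => chartCoord x₀ x (Y x)) x := by
  have h := ((trivializationAt (EuclideanSpace ℝ (Fin n)) (TangentSpace (𝓡 n) : M → Type _)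
    x₀).contMDiffAt_section_iff hx).mp hY
  refine h.congr_of_eventuallyEq ?_
  filter_upwards [(chartAt (EuclideanSpace ℝ (Fin n)) x₀).open_source.mem_nhds hx] with y hy
  rw [chartCoord_apply hy]
  rfl

/-- Differentiability of the sum is proved together with the Leibniz formula, because the induction
step needs it to apply additivity. -/
theorem apply_sum_smul (D : Connection n M) {ι : Type*} (s : Finset ι) {f : ι → M → ℝ}
    {e : ι → Π x : M, TangentSpace (𝓡 n) x} {x : M}
    (hf : ∀ i, MDifferentiableAt (𝓡 n) 𝓘(ℝ, ℝ) (f i) x)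
    (he : ∀ i, DifferentiableFieldAt (e i) x) (v : TangentSpace (𝓡 n) x) :
    DifferentiableFieldAt (∑ i ∈ s, f i • e i) x ∧ D (∑ i ∈ s, f i • e i) x v =
      ∑ i ∈ s, (f i x • D (e i) x v + mvfderiv (𝓡 n) (f i) x v • e i x) := by
  classical
  induction s using Finset.induction_on with
  | empty =>
    simp only [Finset.sum_empty]
    refine ⟨(Bundle.contMDiff_zeroSection ℝ (TangentSpace (𝓡 n) : M → Type _) (n := 1) x).mdifferentiableAt one_ne_zero, ?_⟩
    rw [CovariantDerivative.zero]
    rfl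
  | insert i s hi ih =>
    have h1 : DifferentiableFieldAt (f i • e i) x := (hf i).smul_section (he i)
    rw [Finset.sum_insert hi, Finset.sum_insert hi]
    refine ⟨mdifferentiableAt_add_section h1 ih.1, ?_⟩
    rw [D.isCovariantDerivativeOnUniv.add h1 ih.1, _root_.add_apply, ih.2,
      D.isCovariantDerivativeOnUniv.leibniz (he i) (hf i)]
    rfl

theorem eq_sum_frame {e : Fin n → Π x : M, TangentSpace (𝓡 n) x} {x₀ x : M}
    (hx : x ∈ (chartAt (EuclideanSpace ℝ (Fin n)) x₀).source)
    (he : ∀ i, e i x = (chartFrame x₀ hx).symm (EuclideanSpace.basisFun (Fin n) ℝ i))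
    (v : TangentSpace (𝓡 n) x) : v = ∑ i, (chartCoord x₀ x v) i • e i x := by
  apply (chartFrame x₀ hx).injective
  simp only [map_sum, map_smul, he, ContinuousLinearEquiv.apply_symm_apply]
  rw [← chartCoord_apply hx]
  exact ((EuclideanSpace.basisFun (Fin n) ℝ).sum_repr _).symm

/-- Writing `X = X^i e_i` in the coordinate frame, the Leibniz rule gives `∇_X X = X(X^i) e_i + X^i
X^j ∇_{e_j} e_i`; the last term depends only on the point and on the components of `X`. -/
theorem exists_christoffel [T2Space M] {D : Connection n M} (hD : IsTorsionFree D) (x₀ : M) :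
    ∃ (V : Set M) (F : EuclideanSpace ℝ (Fin n) × EuclideanSpace ℝ (Fin n) →
        EuclideanSpace ℝ (Fin n)), IsOpen V ∧ x₀ ∈ V ∧
      V ⊆ (chartAt (EuclideanSpace ℝ (Fin n)) x₀).source ∧
      ContDiffOn ℝ ∞ F ((extChartAt (𝓡 n) x₀).target ×ˢ Set.univ) ∧
      ∀ x ∈ V, ∀ X : Π x : M, TangentSpace (𝓡 n) x, SmoothField X →
        chartCoord x₀ x (D X x (X x)) =
          mvfderiv (𝓡 n) (fun y => chartCoord x₀ y (X y)) x (X x)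
            + F (extChartAt (𝓡 n) x₀ x, chartCoord x₀ x (X x)) := by
  obtain ⟨e, he, hbase⟩ := exists_frame (n := n) x₀
  obtain ⟨V, hV, hVo, hxV⟩ := eventually_nhds_iff.mp hbase
  let φ := extChartAt (𝓡 n) x₀
  let G : Fin n → Fin n → M → EuclideanSpace ℝ (Fin n) := fun i j x =>
    chartCoord x₀ x (D (e i) x (e j x))
  have hG : ∀ i j, ContDiffOn ℝ ∞ (fun y => G i j (φ.symm y)) φ.target := by
    intro i j
    rw [← contMDiffOn_iff_contDiffOn]
    have h1 : ContMDiffOn (𝓡 n) 𝓘(ℝ, EuclideanSpace ℝ (Fin n)) ∞ (G i j)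
        (chartAt (EuclideanSpace ℝ (Fin n)) x₀).source := fun x hx =>
      (contMDiffAt_chartCoord hx (hD.smoothField_apply (he i) (he j) x)).contMDiffWithinAt
    refine h1.comp (contMDiffOn_extChartAt_symm x₀) fun y hy => ?_
    rw [← extChartAt_source (𝓡 n)]
    exact φ.map_target hy
  -- The fields `e i` are smooth on all of `M`, so `F` is smooth over the whole chart target,
  -- although they are known to be the coordinate fields only on `V`.
  refine ⟨V, fun p => ∑ i, ∑ j, (p.2 i * p.2 j) • G i j (φ.symm p.1), hVo, hxV,
    fun x hx => (hV x hx).1, ?_, fun x hx X hX => ?_⟩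
  · refine ContDiffOn.sum fun i _ => ContDiffOn.sum fun j _ => ?_
    refine ContDiffOn.smul (f := fun p : EuclideanSpace ℝ (Fin n) × EuclideanSpace ℝ (Fin n) =>
      p.2 i * p.2 j) (g := fun p => G i j (φ.symm p.1)) ?_ ?_
    · have h1 : ∀ i : Fin n, ContDiff ℝ ∞ fun p : EuclideanSpace ℝ (Fin n) ×
          EuclideanSpace ℝ (Fin n) => p.2 i := fun i =>
        (EuclideanSpace.proj i : EuclideanSpace ℝ (Fin n) →L[ℝ] ℝ).contDiff.comp contDiff_snd
      exact ((h1 i).mul (h1 j)).contDiffOn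
    · exact (hG i j).comp contDiffOn_fst fun p hp => hp.1
  · obtain ⟨hxs, hex⟩ := hV x hx
    let f : Fin n → M → ℝ := fun i y => chartCoord x₀ y (X y) i
    have hXc : MDifferentiableAt (𝓡 n) 𝓘(ℝ, EuclideanSpace ℝ (Fin n))
        (fun y => chartCoord x₀ y (X y)) x :=
      (contMDiffAt_chartCoord hxs (hX x)).mdifferentiableAt (by simp)
    have hf : ∀ i, HasMFDerivAt (𝓡 n) 𝓘(ℝ, ℝ) (f i) x
        ((EuclideanSpace.proj i : EuclideanSpace ℝ (Fin n) →L[ℝ] ℝ).comp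
          (mfderiv (𝓡 n) 𝓘(ℝ, EuclideanSpace ℝ (Fin n)) (fun y => chartCoord x₀ y (X y)) x)) :=
      fun i => (EuclideanSpace.proj i : EuclideanSpace ℝ (Fin n) →L[ℝ] ℝ).hasFDerivAt.hasMFDerivAt.comp
        x hXc.hasMFDerivAt
    have hsum := apply_sum_smul D Finset.univ (fun i => (hf i).mdifferentiableAt)
      (fun i => (he i x).mdifferentiableAt (by simp)) (X x)
    have hcongr : D X x = D (∑ i, f i • e i) x := by
      refine D.isCovariantDerivativeOnUniv.congr_of_eventuallyEq
        ((hX x).mdifferentiableAt (by simp)) hsum.1 Filter.univ_mem ?_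
      filter_upwards [hVo.mem_nhds hx] with y hy
      obtain ⟨hys, hey⟩ := hV y hy
      rw [eq_sum_frame hys hey (X y), Finset.sum_apply]
      rfl
    have hce : ∀ i, chartCoord x₀ x (e i x) = EuclideanSpace.basisFun (Fin n) ℝ i := by
      intro i
      rw [chartCoord_apply hxs, hex, ContinuousLinearEquiv.apply_symm_apply]
    have hDe : ∀ i, D (e i) x (X x) = ∑ j, f j x • D (e i) x (e j x) := by
      intro i
      conv_lhs => rw [eq_sum_frame hxs hex (X x)]
      simp only [map_sum, map_smul]
      rfl
    rw [hcongr, hsum.2]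
    simp only [map_sum, map_add, map_smul, hce, hDe, Finset.sum_add_distrib, Finset.smul_sum,
      smul_smul]
    rw [add_comm]
    congr 1
    · have h1 : ∀ i, mvfderiv (𝓡 n) (f i) x (X x) = (mvfderiv (𝓡 n)
          (fun y => chartCoord x₀ y (X y)) x (X x)) i := by
        intro i
        rw [mvfderiv, (hf i).mfderiv]
        rfl
      simp only [h1]
      exact (EuclideanSpace.basisFun (Fin n) ℝ).sum_repr _
    · have h2 : φ.symm (φ x) = x := φ.left_inv (by rw [extChartAt_source]; exact hxs)
      change _ = ∑ i, ∑ j, (f i x * f j x) • G i j (φ.symm (φ x))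
      rw [h2]

theorem exists_smoothField_of_chartCoord [T2Space M] {w : M → EuclideanSpace ℝ (Fin n)} {x₀ : M}
    {U : Set M} (hU : U ∈ nhds x₀) (hw : ContMDiffOn (𝓡 n) 𝓘(ℝ, EuclideanSpace ℝ (Fin n)) ∞ w U) :
    ∃ Y : Π x : M, TangentSpace (𝓡 n) x, SmoothField Y ∧
      ∀ᶠ x in nhds x₀, chartCoord x₀ x (Y x) = w x := by
  obtain ⟨e, he, hbase⟩ := exists_frame (n := n) x₀
  have h1 : ContMDiffOn (𝓡 n) (𝓡 n).tangent ∞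
      (fun x => (⟨x, ∑ i, w x i • e i x⟩ : TangentBundle (𝓡 n) M)) U :=
    ContMDiffOn.sum_section fun i _ => ContMDiffOn.smul_section
      ((EuclideanSpace.proj i : EuclideanSpace ℝ (Fin n) →L[ℝ] ℝ).contMDiff.comp_contMDiffOn hw)
      (he i).contMDiffOn
  obtain ⟨Y, hY, hYe⟩ := exists_smoothField_eventuallyEq hU h1
  refine ⟨Y, hY, ?_⟩
  filter_upwards [hYe, hbase] with x hx hb
  obtain ⟨hxs, hex⟩ := hb
  rw [hx, chartCoord_apply hxs]
  simp only [map_sum, map_smul, hex, ContinuousLinearEquiv.apply_symm_apply]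
  exact (EuclideanSpace.basisFun (Fin n) ℝ).sum_repr _

end Manifold
end ProjConf

namespace ProjConf

/-! ### Existence of geodesics and Weyl's theorem on projective equivalence. -/

section Manifold

set_option linter.unusedSectionVars false

variable {n : ℕ} {M : Type*} [TopologicalSpace M] [ChartedSpace (EuclideanSpace ℝ (Fin n)) M]
  [IsManifold (𝓡 n) ∞ M]

theorem mvfderiv_velocity {F : Type*} [NormedAddCommGroup F] [NormedSpace ℝ F] {w : M → F}
    {γ : ℝ → M} {t : ℝ} (hw : MDifferentiableAt (𝓡 n) 𝓘(ℝ, F) w (γ t))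
    (hγ : MDifferentiableAt 𝓘(ℝ, ℝ) (𝓡 n) γ t) :
    mvfderiv (𝓡 n) w (γ t) (velocity γ t) = deriv (fun s => w (γ s)) t := by
  have h := mfderiv_comp t hw hγ
  rw [mfderiv_eq_fderiv] at h
  rw [← fderiv_apply_one_eq_deriv]
  exact (congrArg (fun L => L (1 : ℝ)) h).symm

theorem chartCoord_velocity {γ : ℝ → M} {x₀ : M} {t : ℝ}
    (ht : γ t ∈ (chartAt (EuclideanSpace ℝ (Fin n)) x₀).source)
    (hγ : MDifferentiableAt 𝓘(ℝ, ℝ) (𝓡 n) γ t) :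
    chartCoord x₀ (γ t) (velocity γ t) = deriv (fun s => extChartAt (𝓡 n) x₀ (γ s)) t :=
  mvfderiv_velocity (mdifferentiableAt_extChartAt ht) hγ

theorem chartCoord_injective {x₀ x : M}
    (hx : x ∈ (chartAt (EuclideanSpace ℝ (Fin n)) x₀).source) :
    Function.Injective (chartCoord (n := n) x₀ x) := fun u v h => by
  rw [chartCoord_apply hx, chartCoord_apply hx] at h
  exact (chartFrame x₀ hx).injective h

/-- There is a geodesic with any given non-zero initial velocity, and its velocity extends to a
smooth vector field. -/
theorem exists_geodesic [T2Space M] {D : Connection n M} (hD : IsTorsionFree D) (x₀ : M)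
    {v : TangentSpace (𝓡 n) x₀} (hv : v ≠ 0) :
    ∃ (γ : ℝ → M) (ε : ℝ) (Y : Π x : M, TangentSpace (𝓡 n) x), 0 < ε ∧ γ 0 = x₀ ∧ SmoothField Y ∧
      Y x₀ = v ∧ IsUnparametrisedGeodesic D γ (-ε) ε ∧
      ∀ᶠ s in nhds 0, Y (γ s) = velocity γ s := by
  obtain ⟨V, F, hVo, hxV, hVs, hF, hDF⟩ := exists_christoffel hD x₀
  let φ := extChartAt (𝓡 n) x₀
  have hx₀s := hVs hxV
  have hφx₀ : φ.symm (φ x₀) = x₀ := extChartAt_to_inv x₀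
  -- Velocity zero is excluded from the phase space so that the solution is immersed on its whole
  -- interval.
  let W : Set (EuclideanSpace ℝ (Fin n) × EuclideanSpace ℝ (Fin n)) :=
    (φ.target ∩ φ.symm ⁻¹' V) ×ˢ {0}ᶜ
  have hW : IsOpen W := ((continuousOn_extChartAt_symm x₀).isOpen_inter_preimage
    (isOpen_extChartAt_target x₀) hVo).prod isOpen_compl_singleton
  have h0 : (φ x₀, chartCoord x₀ x₀ v) ∈ W := by
    refine ⟨⟨mem_extChartAt_target x₀, ?_⟩, fun h => hv (chartCoord_injective hx₀s ?_)⟩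
    · change φ.symm (φ x₀) ∈ V
      rwa [hφx₀]
    · rw [map_zero]
      exact h
  obtain ⟨c, ε, hε, hc0, hc0', hc, hcW⟩ := exists_solution_second_order hW (F := fun p => -F p)
    (hF.mono (Set.prod_mono Set.inter_subset_left (Set.subset_univ _))).neg h0
  have hmem0 : (0 : ℝ) ∈ Set.Ioo (-ε) ε := ⟨by linarith, hε⟩
  let γ : ℝ → M := fun t => φ.symm (c t)
  have hγV : ∀ t ∈ Set.Ioo (-ε) ε, γ t ∈ V := fun t ht => (hcW t ht).1.1.2
  have hφγ : ∀ t ∈ Set.Ioo (-ε) ε, φ (γ t) = c t := fun t ht => φ.right_inv (hcW t ht).1.1.1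
  have hγs : ContMDiffOn 𝓘(ℝ, ℝ) (𝓡 n) ∞ γ (Set.Ioo (-ε) ε) :=
    (contMDiffOn_extChartAt_symm x₀).comp (contMDiffOn_iff_contDiffOn.mpr hc)
      fun t ht => (hcW t ht).1.1.1
  have hγd : ∀ t ∈ Set.Ioo (-ε) ε, MDifferentiableAt 𝓘(ℝ, ℝ) (𝓡 n) γ t := fun t ht =>
    (hγs.contMDiffAt (isOpen_Ioo.mem_nhds ht)).mdifferentiableAt (by simp)
  have hvel : ∀ t ∈ Set.Ioo (-ε) ε, chartCoord x₀ (γ t) (velocity γ t) = deriv c t := by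
    intro t ht
    rw [chartCoord_velocity (hVs (hγV t ht)) (hγd t ht)]
    refine Filter.EventuallyEq.deriv_eq ?_
    filter_upwards [isOpen_Ioo.mem_nhds ht] with s hs
    exact hφγ s hs
  have hγ0 : γ 0 = x₀ := by
    change φ.symm (c 0) = x₀
    rw [hc0, hφx₀]
  obtain ⟨θ, U, hU, h0U, hθ, hθm, hθc⟩ := exists_smooth_left_inverse hε hc
    (by rw [hc0']; exact h0.2)
  -- The components at `x` are those of the velocity at time `θ (φ x)`; since `θ` inverts the curve
  -- near time `0`, the field restricts to the velocity along the geodesic.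
  obtain ⟨Y, hY, hYw⟩ := exists_smoothField_of_chartCoord (x₀ := x₀)
    (w := fun x => deriv c (θ (φ x))) (U := φ.source ∩ φ ⁻¹' U)
    ((continuousOn_extChartAt x₀).isOpen_inter_preimage (isOpen_extChartAt_source x₀) hU
      |>.mem_nhds ⟨mem_extChartAt_source x₀, by rwa [hc0] at h0U⟩) (by
      have h1 : ContDiffOn ℝ ∞ (fun y => deriv c (θ y)) U :=
        (hc.deriv_of_isOpen isOpen_Ioo (m := ∞) (by norm_cast)).comp hθ hθm
      refine (contMDiffOn_iff_contDiffOn.mpr h1).comp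
        ((contMDiffOn_extChartAt (x := x₀) (n := ∞)).mono ?_) fun x hx => hx.2
      intro x hx
      rw [← extChartAt_source (𝓡 n)]
      exact hx.1)
  have hext : ∀ᶠ s in nhds 0, Y (γ s) = velocity γ s := by
    have hcont : Filter.Tendsto γ (nhds 0) (nhds x₀) := by
      have := (hγd 0 hmem0).continuousAt.tendsto
      rwa [hγ0] at this
    filter_upwards [hcont.eventually hYw, hθc, isOpen_Ioo.mem_nhds hmem0] with s h1 h2 h3
    refine chartCoord_injective (hVs (hγV s h3)) ?_
    rw [h1, hφγ s h3, h2, hvel s h3]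
  refine ⟨γ, ε, Y, hε, hγ0, hY, ?_, ⟨hγs, fun t ht h => (hcW t ht).1.2 ?_, ?_⟩, hext⟩
  · refine chartCoord_injective hx₀s ?_
    rw [hYw.self_of_nhds, ← hc0, hθc.self_of_nhds, hc0']
  · change deriv c t = 0
    rw [← hvel t ht, h, map_zero]
  · intro t ht X hX hXγ
    -- The factor is `0` because the solution is affinely parametrised: its acceleration cancels the
    -- Christoffel term.
    refine ⟨0, chartCoord_injective (hVs (hγV t ht)) ?_⟩
    have h1 := hDF (γ t) (hγV t ht) X hX
    have h2 : deriv (fun s => chartCoord x₀ (γ s) (X (γ s))) t = deriv (deriv c) t := by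
      refine Filter.EventuallyEq.deriv_eq ?_
      filter_upwards [hXγ, isOpen_Ioo.mem_nhds ht] with s hs hs'
      rw [hs, hvel s hs']
    have h3 : mvfderiv (𝓡 n) (fun y => chartCoord x₀ y (X y)) (γ t) (velocity γ t) = _ :=
      mvfderiv_velocity ((contMDiffAt_chartCoord (hVs (hγV t ht)) (hX _)).mdifferentiableAt
        (by simp)) (hγd t ht)
    rw [hXγ.self_of_nhds, h3, h2, (hcW t ht).2, hvel t ht] at h1
    rw [h1, zero_smul, map_zero]
    change -F (c t, deriv c t) + F (φ (γ t), deriv c t) = 0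
    rw [hφγ t ht, neg_add_cancel]

/-- Weyl's theorem: projectively equivalent connections differ by `ι(ν)` for a `1`-form `ν`. -/
theorem Represents.exists_difference_eq_iota [T2Space M] {D D' : Connection n M}
    {p : ProjectiveStructure n M} (hD : Represents D p) (hD' : Represents D' p) (x : M) :
    ∃ ν : TangentSpace (𝓡 n) x →L[ℝ] ℝ, D.difference D' x = iota ν := by
  obtain ⟨h, hp⟩ := hD
  obtain ⟨h', hp'⟩ := hD'
  have hrel : ∀ (γ : ℝ → M) (a b : ℝ),
      IsUnparametrisedGeodesic D γ a b ↔ IsUnparametrisedGeodesic D' γ a b :=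
    Quotient.exact (s := projectiveSetoid n M) (hp.trans hp'.symm)
  refine exists_eq_iota_of_diag (difference_symm h.1 h'.1 x) fun v => ?_
  by_cases hv : v = 0
  · exact ⟨0, by simp [hv]⟩
  obtain ⟨γ, ε, Y, hε, hγ0, hY, hYv, hγ, hYγ⟩ := exists_geodesic h x hv
  have hmem0 : (0 : ℝ) ∈ Set.Ioo (-ε) ε := ⟨by linarith, hε⟩
  -- Both connections are evaluated on the same extension `Y` of the velocity, so the difference
  -- tensor sends `(v, v)` to `(k - k') v`. The geodesic condition constrains only such extensions,
  -- hence the need for one.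
  obtain ⟨k, hk⟩ := hγ.geodesic 0 hmem0 Y hY hYγ
  obtain ⟨k', hk'⟩ := ((hrel γ _ _).mp hγ).geodesic 0 hmem0 Y hY hYγ
  rw [← hYγ.self_of_nhds, hγ0] at hk hk'
  refine ⟨k - k', ?_⟩
  rw [← hYv, difference_apply D D' ((hY x).mdifferentiableAt (by simp)), _root_.sub_apply, hk, hk',
    sub_smul]

theorem isUnparametrisedGeodesic_of_difference_eq_iota {D D' : Connection n M}
    (h : ∀ x, ∃ ν : TangentSpace (𝓡 n) x →L[ℝ] ℝ, D.difference D' x = iota ν) {γ : ℝ → M} {a b : ℝ}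
    (hγ : IsUnparametrisedGeodesic D' γ a b) : IsUnparametrisedGeodesic D γ a b := by
  refine ⟨hγ.smooth, hγ.immersed, fun t ht X hX hXγ => ?_⟩
  obtain ⟨k, hk⟩ := hγ.geodesic t ht X hX hXγ
  obtain ⟨ν, hν⟩ := h (γ t)
  refine ⟨k + 2 * ν (velocity γ t), ?_⟩
  rw [apply_eq_add_difference D D' ((hX _).mdifferentiableAt (by simp)), hk, hν,
    hXγ.self_of_nhds, iota_apply]
  module

theorem Represents.of_difference_eq_iota {D D' : Connection n M} {p : ProjectiveStructure n M}
    (hD' : Represents D' p) (hD : IsTorsionFree D)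
    (h : ∀ x, ∃ ν : TangentSpace (𝓡 n) x →L[ℝ] ℝ, D.difference D' x = iota ν) : Represents D p := by
  obtain ⟨h', rfl⟩ := hD'
  refine ⟨hD, Quotient.sound (s := projectiveSetoid n M) fun γ a b => ⟨fun hγ => ?_, fun hγ => ?_⟩⟩
  · refine isUnparametrisedGeodesic_of_difference_eq_iota (fun x => ?_) hγ
    obtain ⟨ν, hν⟩ := h x
    exact ⟨-ν, by rw [difference_swap, hν, iota_neg]⟩
  · exact isUnparametrisedGeodesic_of_difference_eq_iota h hγ

theorem represents_rep (p : ProjectiveStructure n M) : Represents p.rep.1 p :=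
  ⟨p.rep.2, @Quotient.out_eq _ (projectiveSetoid n M) p⟩

end Manifold
end ProjConf

namespace ProjConf

/-! ### Invariance of `A`, the canonical conformal connection, and the transformation groups. -/

section Manifold

set_option linter.unusedSectionVars false

variable {n : ℕ} {M : Type*} [TopologicalSpace M] [ChartedSpace (EuclideanSpace ℝ (Fin n)) M]
  [IsManifold (𝓡 n) ∞ M]

/-! ### Invariance of `A_{[g]}` -/

theorem tensorA_eq_primitivePart (p : ProjectiveStructure n M) (g : Metric n M) (x : M) :
    tensorA p g x = primitivePart (tangentBasis x) (g.inner x) (differenceLC p g x) := by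
  rw [tensorA, primitivePart, vectorX, correctionVec, finrank_tangentSpace]

theorem traceFree_zero {V : Type*} [AddCommGroup V] [Module ℝ V] [TopologicalSpace V]
    [IsTopologicalAddGroup V] [ContinuousSMul ℝ V] [FiniteDimensional ℝ V] [T2Space V] :
    traceFree (0 : V →L[ℝ] V →L[ℝ] V) = 0 := by
  have h : (0 : V →L[ℝ] V →L[ℝ] V) = iota 0 := by
    ext X Y
    simp
  rw [h, traceFree_iota]
  exact h

/-- Replacing the chosen representative by `D` adds `ι(ν)`, and replacing the Levi-Civita connection
by `D₀` adds `ι(β) - g ⊗ β^♯`; `primitivePart` sees neither. The Weyl condition on `D₀` is needed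
only at `x`. -/
theorem tensorA_eq_of_conformal [T2Space M] (hn : 2 ≤ n) {p : ProjectiveStructure n M}
    {g : Metric n M} {D D₀ : Connection n M} (hD : Represents D p) (h₀ : D₀.torsion = 0) {x : M}
    {β : TangentSpace (𝓡 n) x →L[ℝ] ℝ}
    (hβ : ∀ u w v, nablaMetric g D₀ x u w v = 2 * β v * g.inner x u w) :
    tensorA p g x = primitivePart (tangentBasis x) (g.inner x) (D.difference D₀ x) := by
  have hLC := isLeviCivita_leviCivita g ⟨p.rep⟩
  obtain ⟨ν, hν⟩ := hD.exists_difference_eq_iota (represents_rep p) x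
  obtain ⟨Z, hZ⟩ := exists_dual (g.pos x) β
  have h1 := eq_iota_sub_tensorVec (g.symm x) (g.pos x) (difference_symm hLC.1 h₀ x) hZ
    fun u w v => by
      have h := nablaMetric_eq_sub g (leviCivita g ⟨p.rep⟩) D₀ x u w v
      rw [hLC.2 x, hβ] at h
      simp only [_root_.zero_apply] at h
      linarith
  have h2 : D.difference D₀ x = differenceLC p g x + tensorVec (g.inner x) (-Z) + iota (ν + β) := by
    rw [difference_add_difference D p.rep.1, difference_add_difference p.rep.1
      (leviCivita g ⟨p.rep⟩), hν, h1, differenceLC, iota_add]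
    ext u v
    simp only [_root_.add_apply, _root_.sub_apply, tensorVec_apply]
    module
  rw [h2, primitivePart_add (by rwa [finrank_tangentSpace]) _ (g.symm x) (g.pos x),
    tensorA_eq_primitivePart]

/-- The Levi-Civita connection of `e^{2f} g` is a Weyl connection of `g` with `β = -df`, and
`primitivePart` depends on the metric only up to scale. -/
theorem tensorA_conformal [T2Space M] (hn : 2 ≤ n) (p : ProjectiveStructure n M)
    {g g' : Metric n M} (h : ConformallyEquivalent g g') (x : M) :
    tensorA p g' x = tensorA p g x := by
  obtain ⟨f, hf, hg⟩ := h
  have hLC := isLeviCivita_leviCivita g' ⟨p.rep⟩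
  have hinner : g'.inner x = Real.exp (2 * f x) • g.inner x := by
    ext u v
    exact hg x u v
  have h0 := tensorA_eq_of_conformal hn (g := g) (represents_rep p) hLC.1
    (β := -mvfderiv (𝓡 n) f x) fun u w v => by
      have h1 := nablaMetric_of_conformal (hf.mdifferentiable (by simp)) hg
        (leviCivita g' ⟨p.rep⟩) x u w v
      rw [hLC.2 x] at h1
      have h2 := (mul_eq_zero.mp h1.symm).resolve_left (Real.exp_ne_zero _)
      change _ = 2 * -(mvfderiv (𝓡 n) f x v) * _
      linarith
  rw [h0, tensorA_eq_primitivePart, hinner,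
    primitivePart_smul_left _ (g.pos x) (Real.exp_ne_zero _), differenceLC]

theorem Proj.exists_difference_eq_iota {p : ProjectiveStructure n M}
    {Φ : M ≃ₘ^∞⟮𝓡 n, 𝓡 n⟯ M} (hΦ : Φ ∈ Proj p) {D : Connection n M} (hD : Represents D p) (x : M) :
    ∃ ν : TangentSpace (𝓡 n) x →L[ℝ] ℝ, (pullback Φ D).difference D x = iota ν :=
  exists_eq_iota_of_traceFree_eq_zero (hΦ D hD x)

/-- The pull-back of the Levi-Civita connection of `g` is torsion-free and annihilates `Φ^*g`, so it
computes `A_{[Φ^*g]}`. The pulled-back representative differs from the original by a pure trace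
because `Φ` is projective. -/
theorem differential_tensorA [T2Space M] (hn : 2 ≤ n) {p : ProjectiveStructure n M}
    (g : Metric n M) {Φ : M ≃ₘ^∞⟮𝓡 n, 𝓡 n⟯ M} (hΦ : Φ ∈ Proj p) (x : M)
    (u v : TangentSpace (𝓡 n) x) :
    differential Φ x (tensorA p (pullbackMetric Φ g) x u v) =
      tensorA p g (Φ x) (differential Φ x u) (differential Φ x v) := by
  have hLC := isLeviCivita_leviCivita g ⟨p.rep⟩
  obtain ⟨ν, hν⟩ := Proj.exists_difference_eq_iota hΦ (represents_rep p) x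
  have h1 := tensorA_eq_of_conformal hn (g := pullbackMetric Φ g) (x := x) (β := 0)
    (represents_rep p) (torsion_pullback Φ hLC.1) fun u w v => by
      rw [nablaMetric_pullback, hLC.2 (Φ x)]
      simp
  -- The zero vector term is included only to match the form of `primitivePart_add`.
  have h2 : p.rep.1.difference (pullback Φ (leviCivita g ⟨p.rep⟩)) x =
      (pullback Φ p.rep.1).difference (pullback Φ (leviCivita g ⟨p.rep⟩)) x
        + tensorVec ((pullbackMetric Φ g).inner x) 0 + iota (-ν) := by
    rw [difference_add_difference p.rep.1 (pullback Φ p.rep.1), difference_swap p.rep.1, hν,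
      iota_neg]
    ext u v
    simp only [_root_.add_apply, tensorVec_apply]
    module
  rw [h1, h2, primitivePart_add (by rwa [finrank_tangentSpace]) _ ((pullbackMetric Φ g).symm x)
    ((pullbackMetric Φ g).pos x), tensorA_eq_primitivePart]
  exact primitivePart_map (differential Φ x) _ _ (g.symm (Φ x)) (g.pos (Φ x)) (fun _ _ => rfl)
    (fun X Y => differential_difference_pullback Φ _ _ x X Y) u v

/-! ### The canonical conformal connection -/

theorem tensorA_symm (p : ProjectiveStructure n M) (g : Metric n M) (x : M)
    (u v : TangentSpace (𝓡 n) x) : tensorA p g x u v = tensorA p g x v u := by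
  have hLC := isLeviCivita_leviCivita g ⟨p.rep⟩
  refine traceFree_symm (fun u v => ?_) u v
  rw [_root_.sub_apply, _root_.sub_apply, _root_.sub_apply, _root_.sub_apply, tensorVec_apply,
    tensorVec_apply, g.symm x u v, differenceLC, difference_symm p.rep.2.1 hLC.1]

/-- There is a conformal connection `D` such that `D + A_{[g]}` represents the projective
structure. -/
theorem exists_isConformalConnection [T2Space M] (p : ProjectiveStructure n M) (g : Metric n M) :
    ∃ D : Connection n M, IsConformalConnection g D ∧ Represents (D.addOneForm (tensorA p g)) p := by
  have hLC := isLeviCivita_leviCivita g ⟨p.rep⟩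
  -- With this `S`, the connection `∇ + S` is `ᵍ∇ + g ⊗ X_g - ι(X_g^♭)`, the Weyl connection with `β
  -- = X_g^♭`. Adding `A_{[g]}` returns `∇` up to pure trace, since `A_{[g]}` is the trace-free part
  -- of `∇ - ᵍ∇ - g ⊗ X_g`.
  let S : Π x : M, TangentSpace (𝓡 n) x →L[ℝ] TangentSpace (𝓡 n) x →L[ℝ] TangentSpace (𝓡 n) x :=
    fun x => tensorVec (g.inner x) (vectorX p g x) - differenceLC p g x
      - iota (g.inner x (vectorX p g x))
  have hS : SmoothTensor S := ((smoothTensor_tensorVec g (smoothField_vectorX p g)).sub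
    (smoothTensor_differenceLC p g)).sub (smoothForm_inner g (smoothField_vectorX p g)).iota
  have hSs : ∀ x u v, S x u v = S x v u := by
    intro x u v
    simp only [S, _root_.sub_apply, tensorVec_apply, iota_apply]
    rw [g.symm x u v, differenceLC, difference_symm p.rep.2.1 hLC.1 x u v,
      add_comm (_ • v) (_ • u)]
  have hD : IsTorsionFree (p.rep.1.addOneForm S) := p.rep.2.addOneForm hS hSs
  refine ⟨p.rep.1.addOneForm S, ⟨hD, fun x => g.inner x (vectorX p g x), fun x u w v => ?_⟩,
    (represents_rep p).of_difference_eq_iota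
      (hD.addOneForm (smoothTensor_tensorA p g) (tensorA_symm p g)) fun x => ?_⟩
  · rw [nablaMetric_eq_sub g _ (leviCivita g ⟨p.rep⟩), hLC.2 x,
      difference_add_difference _ p.rep.1, addOneForm_difference]
    have h : ∀ u v, (S x + p.rep.1.difference (leviCivita g ⟨p.rep⟩) x) u v =
        g.inner x u v • vectorX p g x
          - (g.inner x (vectorX p g x) u • v + g.inner x (vectorX p g x) v • u) := by
      intro u v
      simp only [S, _root_.add_apply, _root_.sub_apply, tensorVec_apply, iota_apply, differenceLC]
      abel
    rw [h, h]
    simp only [map_sub, map_add, map_smul, _root_.sub_apply, _root_.add_apply, _root_.smul_apply,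
      _root_.zero_apply, smul_eq_mul]
    rw [g.symm x u (vectorX p g x), g.symm x v w]
    ring
  · rw [difference_add_difference _ (p.rep.1.addOneForm S), addOneForm_difference,
      addOneForm_difference]
    refine ⟨-(((Module.finrank ℝ (TangentSpace (𝓡 n) x) : ℝ) + 1)⁻¹ • tr (differenceLC p g x
      - tensorVec (g.inner x) (vectorX p g x)) + g.inner x (vectorX p g x)), ?_⟩
    rw [iota_neg, iota_add, iota_smul]
    ext u v
    simp only [S, tensorA, traceFree, _root_.add_apply, _root_.sub_apply, _root_.neg_apply]
    abel

theorem difference_eq_zero_of_conformal (hn : 2 ≤ n) {g : Metric n M} {D D' : Connection n M}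
    (hD : D.torsion = 0) (hD' : D'.torsion = 0) {x : M} {β β' : TangentSpace (𝓡 n) x →L[ℝ] ℝ}
    (hβ : ∀ u w v, nablaMetric g D x u w v = 2 * β v * g.inner x u w)
    (hβ' : ∀ u w v, nablaMetric g D' x u w v = 2 * β' v * g.inner x u w)
    (h0 : traceFree (D'.difference D x) = 0) : D'.difference D x = 0 := by
  refine eq_zero_of_eq_iota (by rwa [finrank_tangentSpace]) (g.symm x) (g.pos x)
    (difference_symm hD' hD x) (η := β - β') (fun u w v => ?_) h0
  have h := nablaMetric_eq_sub g D' D x u w v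
  rw [hβ, hβ'] at h
  rw [_root_.sub_apply]
  linarith

/-- The tensor `A` cancels in the difference, so by Weyl's theorem the two conformal connections
differ by a pure trace. -/
theorem IsConformalConnection.sameConnection [T2Space M] (hn : 2 ≤ n) {p : ProjectiveStructure n M}
    {g : Metric n M} {A : Π x : M, TangentSpace (𝓡 n) x →L[ℝ] TangentSpace (𝓡 n) x →L[ℝ]
      TangentSpace (𝓡 n) x} {D D' : Connection n M} (hD : IsConformalConnection g D)
    (hD' : IsConformalConnection g D') (h : Represents (D.addOneForm A) p)
    (h' : Represents (D'.addOneForm A) p) : SameConnection D' D := by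
  intro x
  obtain ⟨β, hβ⟩ := hD.2
  obtain ⟨β', hβ'⟩ := hD'.2
  obtain ⟨ν, hν⟩ := h'.exists_difference_eq_iota h x
  rw [addOneForm_difference_addOneForm, add_sub_cancel_right] at hν
  exact difference_eq_zero_of_conformal hn hD.1.1 hD'.1.1 (hβ x) (hβ' x)
    (by rw [hν, traceFree_iota])

/-! ### Transformation groups -/

/-- For another representative `D'`, split `Φ^*D' - D'` as `(Φ^*D' - Φ^*D) + (Φ^*D - D) + (D - D')`.
The middle term is zero, and the outer ones are pure trace by Weyl's theorem and its pull-back. -/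
theorem aff_subset_proj [T2Space M] {p : ProjectiveStructure n M} {D : Connection n M}
    (hD : Represents D p) : Aff D ⊆ Proj p := by
  intro Φ hΦ D' hD' x
  obtain ⟨ν, hν⟩ := hD.exists_difference_eq_iota hD' x
  obtain ⟨ν', hν'⟩ := hD'.exists_difference_eq_iota hD (Φ x)
  have h1 : traceFree ((pullback Φ D').difference (pullback Φ D) x) = 0 := by
    ext u v
    apply (differential Φ x).injective
    rw [traceFree_map (differential Φ x) (differential_difference_pullback Φ D' D x), hν',
      traceFree_iota]
    exact (map_zero _).symm
  rw [difference_add_difference _ (pullback Φ D), difference_add_difference (pullback Φ D) D,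
    hΦ x, hν, traceFree_add, h1, traceFree_add_iota, traceFree_zero]
  ext u v
  exact add_zero (0 : TangentSpace (𝓡 n) x)

theorem mem_aff_of_conformal [T2Space M] (hn : 2 ≤ n) {p : ProjectiveStructure n M}
    {g : Metric n M} {D : Connection n M} (hD : IsConformalConnection g D)
    (hDA : Represents (D.addOneForm (tensorA p g)) p) {Φ : M ≃ₘ^∞⟮𝓡 n, 𝓡 n⟯ M} (hΦ : Φ ∈ Proj p)
    (hg : ConformallyEquivalent g (pullbackMetric Φ g)) :
    Φ ∈ Aff (D.addOneForm (tensorA p g)) := by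
  intro x
  obtain ⟨β, hβ⟩ := hD.2
  -- The tensor `A_{[g]}` drops out because `Φ` preserves it: naturality gives `A_{[Φ^*g]}`, which
  -- is `A_{[g]}` by conformal invariance.
  have hK : (pullback Φ (D.addOneForm (tensorA p g))).difference (D.addOneForm (tensorA p g)) x =
      (pullback Φ D).difference D x := by
    have h1 : (pullback Φ (D.addOneForm (tensorA p g))).difference (pullback Φ D) x =
        tensorA p g x := by
      ext u v
      apply (differential Φ x).injective
      rw [differential_difference_pullback, addOneForm_difference,
        ← tensorA_conformal hn p hg x, differential_tensorA hn g hΦ]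
    rw [difference_add_difference _ (pullback Φ D), difference_add_difference (pullback Φ D) D, h1,
      difference_swap D, addOneForm_difference]
    ext u v
    simp only [_root_.add_apply, _root_.neg_apply]
    abel
  rw [hK]
  have h0 := hΦ _ hDA x
  rw [hK] at h0
  obtain ⟨f, hf, hgf⟩ := hg
  -- Since `Φ^*g = e^{2f} g`, the pulled-back connection is conformal for `g`, with `1`-form `Φ^*β -
  -- df`.
  refine difference_eq_zero_of_conformal hn (g := g) hD.1.1 (torsion_pullback Φ hD.1.1) (hβ x)
    (β' := (β (Φ x)).comp (differential Φ x : _ →L[ℝ] _) - mvfderiv (𝓡 n) f x)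
    (fun u w v => ?_) h0
  have h1 := nablaMetric_of_conformal (hf.mdifferentiable (by simp)) hgf (pullback Φ D) x u w v
  rw [nablaMetric_pullback, hβ, ← pullbackMetric_apply, hgf, mul_left_comm] at h1
  have h2 := mul_left_cancel₀ (Real.exp_ne_zero _) h1
  rw [_root_.sub_apply]
  change _ = 2 * (β (Φ x) (differential Φ x v) - _) * _
  linarith

end Manifold
end ProjConf

namespace ProjConf

/-! ### Change of variables for the volume integral and the energy. -/

section Manifold

set_option linter.unusedSectionVars false

variable {n : ℕ} {M : Type*} [TopologicalSpace M] [ChartedSpace (EuclideanSpace ℝ (Fin n)) M]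
  [IsManifold (𝓡 n) ∞ M]

/-! ### Invariance of the energy -/

/-- The coordinate expression of a diffeomorphism in the charts at `x₀` and `x₁`. -/
noncomputable def inCharts (Φ : M ≃ₘ^∞⟮𝓡 n, 𝓡 n⟯ M) (x₀ x₁ : M) (y : EuclideanSpace ℝ (Fin n)) :
    EuclideanSpace ℝ (Fin n) :=
  chartAt (EuclideanSpace ℝ (Fin n)) x₁ (Φ ((chartAt (EuclideanSpace ℝ (Fin n)) x₀).symm y))

theorem mdifferentiableAt_chart_symm {x₀ : M} {y : EuclideanSpace ℝ (Fin n)}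
    (hy : y ∈ (chartAt (EuclideanSpace ℝ (Fin n)) x₀).target) :
    MDifferentiableAt (𝓡 n) (𝓡 n) (chartAt (EuclideanSpace ℝ (Fin n)) x₀).symm y :=
  mdifferentiableAt_atlas_symm (chart_mem_atlas _ x₀) hy

theorem differentiableAt_inCharts (Φ : M ≃ₘ^∞⟮𝓡 n, 𝓡 n⟯ M) {x₀ x₁ : M}
    {y : EuclideanSpace ℝ (Fin n)} (hy : y ∈ (chartAt (EuclideanSpace ℝ (Fin n)) x₀).target)
    (hy' : Φ ((chartAt (EuclideanSpace ℝ (Fin n)) x₀).symm y) ∈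
      (chartAt (EuclideanSpace ℝ (Fin n)) x₁).source) :
    DifferentiableAt ℝ (inCharts Φ x₀ x₁) y := by
  rw [← mdifferentiableAt_iff_differentiableAt]
  exact (mdifferentiableAt_atlas (chart_mem_atlas _ x₁) hy').comp y
    ((Φ.mdifferentiable (by simp) _).comp y (mdifferentiableAt_chart_symm hy))

/-- Both sides differentiate the same map near `y`: `Φ` after the inverse chart at `x₀`, and the
inverse chart at `x₁` after the coordinate expression of `Φ`. -/
theorem mfderiv_chart_symm_fderiv (Φ : M ≃ₘ^∞⟮𝓡 n, 𝓡 n⟯ M) {x₀ x₁ : M}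
    {y : EuclideanSpace ℝ (Fin n)} (hy : y ∈ (chartAt (EuclideanSpace ℝ (Fin n)) x₀).target)
    (hy' : Φ ((chartAt (EuclideanSpace ℝ (Fin n)) x₀).symm y) ∈
      (chartAt (EuclideanSpace ℝ (Fin n)) x₁).source) (v : EuclideanSpace ℝ (Fin n)) :
    (differential Φ _ (mfderiv (𝓡 n) (𝓡 n) (chartAt (EuclideanSpace ℝ (Fin n)) x₀).symm y v) :
      EuclideanSpace ℝ (Fin n)) =
    mfderiv (𝓡 n) (𝓡 n) (chartAt (EuclideanSpace ℝ (Fin n)) x₁).symm (inCharts Φ x₀ x₁ y)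
      (fderiv ℝ (inCharts Φ x₀ x₁) y v) := by
  let φ := chartAt (EuclideanSpace ℝ (Fin n)) x₀
  let ψ := chartAt (EuclideanSpace ℝ (Fin n)) x₁
  have h1 := mfderiv_comp y (Φ.mdifferentiable (by simp) (φ.symm y))
    (mdifferentiableAt_chart_symm hy)
  have h2 := mfderiv_comp y (mdifferentiableAt_chart_symm (x₀ := x₁) (y := inCharts Φ x₀ x₁ y)
    (ψ.map_source hy')) (differentiableAt_inCharts Φ hy hy').mdifferentiableAt
  have h3 : (ψ.symm ∘ inCharts Φ x₀ x₁) =ᶠ[nhds y] (Φ ∘ φ.symm) := by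
    have hc : ContinuousAt (Φ ∘ φ.symm) y :=
      Φ.continuous.continuousAt.comp (φ.continuousAt_symm hy)
    filter_upwards [hc.preimage_mem_nhds (ψ.open_source.mem_nhds hy')] with z hz
    exact ψ.left_inv hz
  have h4 := h3.mfderiv_eq (I := 𝓡 n) (I' := 𝓡 n)
  rw [mfderiv_eq_fderiv] at h2
  exact congrArg (fun L : EuclideanSpace ℝ (Fin n) →L[ℝ] EuclideanSpace ℝ (Fin n) => L v)
    ((h1.symm.trans h4.symm).trans h2)

/-- Precomposition with `A` turns the Gram matrix `G` into `Nᵀ G N`, where `N` is the matrix of `A`.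
-/
theorem det_of_comp {E V ι : Type*} [NormedAddCommGroup E] [NormedSpace ℝ E] [AddCommGroup V]
    [Module ℝ V] [TopologicalSpace V] [IsTopologicalAddGroup V] [ContinuousSMul ℝ V] [Fintype ι]
    [DecidableEq ι] (b : Module.Basis ι ℝ E) (B : V →L[ℝ] V →L[ℝ] ℝ) (L : E →L[ℝ] V)
    (A : E →L[ℝ] E) : (Matrix.of fun k l => B (L (A (b k))) (L (A (b l)))).det =
      A.det ^ 2 * (Matrix.of fun k l => B (L (b k)) (L (b l))).det := by
  let N := LinearMap.toMatrix b b (A : E →ₗ[ℝ] E)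
  have hA : A.det = N.det := (LinearMap.det_toMatrix b _).symm
  have hcol : ∀ k, A (b k) = ∑ a, N a k • b a := by
    intro k
    simp only [N, LinearMap.toMatrix_apply]
    exact (b.sum_repr (A (b k))).symm
  have hmat : (Matrix.of fun k l => B (L (A (b k))) (L (A (b l)))) =
      N.transpose * (Matrix.of fun k l => B (L (b k)) (L (b l))) * N := by
    ext k l
    simp only [hcol, map_sum, map_smul, _root_.sum_apply, _root_.smul_apply, smul_eq_mul,
      Matrix.mul_apply, Matrix.transpose_apply, Matrix.of_apply, Finset.sum_mul, Finset.mul_sum]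
    refine Finset.sum_congr rfl fun i _ => Finset.sum_congr rfl fun j _ => ?_
    ring
  rw [hmat, Matrix.det_mul, Matrix.det_mul, Matrix.det_transpose, hA]
  ring

theorem coordMetric_pullback [T2Space M] (Φ : M ≃ₘ^∞⟮𝓡 n, 𝓡 n⟯ M) (g : Metric n M) {x₀ x₁ : M}
    {y : EuclideanSpace ℝ (Fin n)} (hy : y ∈ (chartAt (EuclideanSpace ℝ (Fin n)) x₀).target)
    (hy' : Φ ((chartAt (EuclideanSpace ℝ (Fin n)) x₀).symm y) ∈
      (chartAt (EuclideanSpace ℝ (Fin n)) x₁).source) :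
    (coordMetric (pullbackMetric Φ g) x₀ y).det =
      (fderiv ℝ (inCharts Φ x₀ x₁) y).det ^ 2 * (coordMetric g x₁ (inCharts Φ x₀ x₁ y)).det := by
  have hpt : Φ ((chartAt (EuclideanSpace ℝ (Fin n)) x₀).symm y) =
      (chartAt (EuclideanSpace ℝ (Fin n)) x₁).symm (inCharts Φ x₀ x₁ y) :=
    ((chartAt (EuclideanSpace ℝ (Fin n)) x₁).left_inv hy').symm
  -- All tangent spaces are the same type `ℝⁿ`, so the base point can be replaced while the vectors
  -- stay fixed.
  have hB : ∀ u v : EuclideanSpace ℝ (Fin n),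
      g.inner (Φ ((chartAt (EuclideanSpace ℝ (Fin n)) x₀).symm y)) u v =
      g.inner ((chartAt (EuclideanSpace ℝ (Fin n)) x₁).symm (inCharts Φ x₀ x₁ y)) u v := by
    intro u v
    rw [hpt]
  have hmat : coordMetric (pullbackMetric Φ g) x₀ y = Matrix.of fun k l =>
      g.inner ((chartAt (EuclideanSpace ℝ (Fin n)) x₁).symm (inCharts Φ x₀ x₁ y))
        (mfderiv (𝓡 n) (𝓡 n) (chartAt (EuclideanSpace ℝ (Fin n)) x₁).symm (inCharts Φ x₀ x₁ y)
          (fderiv ℝ (inCharts Φ x₀ x₁) y (EuclideanSpace.basisFun (Fin n) ℝ k)))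
        (mfderiv (𝓡 n) (𝓡 n) (chartAt (EuclideanSpace ℝ (Fin n)) x₁).symm (inCharts Φ x₀ x₁ y)
          (fderiv ℝ (inCharts Φ x₀ x₁) y (EuclideanSpace.basisFun (Fin n) ℝ l))) := by
    ext k l
    refine (hB _ _).trans ?_
    rw [Matrix.of_apply, ← mfderiv_chart_symm_fderiv Φ hy hy', ← mfderiv_chart_symm_fderiv Φ hy hy']
  rw [hmat]
  have h := det_of_comp (EuclideanSpace.basisFun (Fin n) ℝ).toBasis
    (g.inner ((chartAt (EuclideanSpace ℝ (Fin n)) x₁).symm (inCharts Φ x₀ x₁ y)))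
    (mfderiv (𝓡 n) (𝓡 n) (chartAt (EuclideanSpace ℝ (Fin n)) x₁).symm (inCharts Φ x₀ x₁ y))
    (fderiv ℝ (inCharts Φ x₀ x₁) y)
  simp only [OrthonormalBasis.coe_toBasis] at h
  exact h

theorem measurableSet_image_chart [MeasurableSpace M] [BorelSpace M]
    (φ : OpenPartialHomeomorph M (EuclideanSpace ℝ (Fin n))) {P : Set M} (hP : MeasurableSet P)
    (hs : P ⊆ φ.source) : MeasurableSet (φ '' P) := by
  rw [φ.image_eq_target_inter_inv_preimage hs]
  have h := φ.open_target.measurableSet.subtype_image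
    ((continuousOn_iff_continuous_domRestrict.mp φ.continuousOn_symm).measurable hP)
  convert h using 1
  ext y
  simp [and_comm]

theorem disjoint_image_of_injOn {α β : Type*} {φ : α → β} {S P Q : Set α} (h : Set.InjOn φ S)
    (hP : P ⊆ S) (hQ : Q ⊆ S) (hd : Disjoint P Q) : Disjoint (φ '' P) (φ '' Q) := by
  rw [Set.disjoint_iff_inter_eq_empty, ← h.image_inter hP hQ, hd.inter_eq, Set.image_empty]

/-- The two densities differ by the Jacobian `|det|` of `Φ` in charts, which the change of variables
formula absorbs. The chart pieces are refined by their preimages under `Φ` and `Φ⁻¹`, so that `Φ`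
carries each small piece into a single chart. Only the pieces need be measurable; `f` is arbitrary.
-/
theorem volumeIntegral_pullback [T2Space M] [SecondCountableTopology M] [Nonempty M]
    (Φ : M ≃ₘ^∞⟮𝓡 n, 𝓡 n⟯ M) (g : Metric n M) (f : M → ℝ≥0∞) :
    volumeIntegral (pullbackMetric Φ g) (fun x => f (Φ x)) = volumeIntegral g f := by
  let _ : MeasurableSpace M := borel M
  have _ : BorelSpace M := ⟨rfl⟩
  let c := (exists_countable_chart_cover n M).choose
  have hc : ⋃ i, (chartAt (EuclideanSpace ℝ (Fin n)) (c i)).source = Set.univ :=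
    (exists_countable_chart_cover n M).choose_spec
  let φ := fun i => chartAt (EuclideanSpace ℝ (Fin n)) (c i)
  let P : ℕ → Set M := disjointed fun j => (φ j).source
  have hPm : ∀ i, MeasurableSet (P i) :=
    fun i => MeasurableSet.disjointed (fun j => (φ j).open_source.measurableSet) i
  have hPs : ∀ i, P i ⊆ (φ i).source := fun i => disjointed_subset _ i
  have hPu : ⋃ i, P i = Set.univ := (iUnion_disjointed (f := fun j => (φ j).source)).trans hc
  have hPd : Pairwise (Function.onFun Disjoint P) := disjoint_disjointed _
  have hcut : ∀ (i : ℕ) (Q : ℕ → Set M) (F : EuclideanSpace ℝ (Fin n) → ℝ≥0∞),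
      (∀ j, MeasurableSet (Q j)) → (⋃ j, Q j = Set.univ) →
      Pairwise (Function.onFun Disjoint Q) →
      ∫⁻ y in φ i '' P i, F y = ∑' j, ∫⁻ y in φ i '' (P i ∩ Q j), F y := by
    intro i Q F hQm hQu hQd
    have h : φ i '' P i = ⋃ j, φ i '' (P i ∩ Q j) := by
      rw [← Set.image_iUnion, ← Set.inter_iUnion, hQu, Set.inter_univ]
    rw [h]
    refine MeasureTheory.lintegral_iUnion (fun j => measurableSet_image_chart (φ i)
      ((hPm i).inter (hQm j)) (Set.inter_subset_left.trans (hPs i))) (fun j k hjk => ?_) F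
    exact disjoint_image_of_injOn (φ i).injOn (Set.inter_subset_left.trans (hPs i))
      (Set.inter_subset_left.trans (hPs i))
      ((hQd hjk).mono Set.inter_subset_right Set.inter_subset_right)
  have hΦ : Measurable Φ := Φ.continuous.measurable
  have hΦ' : Measurable Φ.symm := Φ.symm.continuous.measurable
  have hpre : ∀ Ψ : M → M, Measurable Ψ → (∀ j, MeasurableSet (Ψ ⁻¹' P j)) ∧
      (⋃ j, Ψ ⁻¹' P j = Set.univ) ∧ Pairwise (Function.onFun Disjoint fun j => Ψ ⁻¹' P j) :=
    fun Ψ hΨ => ⟨fun j => hΨ (hPm j), by rw [← Set.preimage_iUnion, hPu, Set.preimage_univ],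
      fun j k hjk => (hPd hjk).preimage Ψ⟩
  change ∑' i, ∫⁻ y in φ i '' P i, f (Φ ((φ i).symm y)) *
      ENNReal.ofReal (Real.sqrt (coordMetric (pullbackMetric Φ g) (c i) y).det) =
    ∑' i, ∫⁻ y in φ i '' P i, f ((φ i).symm y) *
      ENNReal.ofReal (Real.sqrt (coordMetric g (c i) y).det)
  have h1 := fun i => hcut i (fun j => Φ ⁻¹' P j) (fun y => f (Φ ((φ i).symm y)) *
      ENNReal.ofReal (Real.sqrt (coordMetric (pullbackMetric Φ g) (c i) y).det)) (hpre Φ hΦ).1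
      (hpre Φ hΦ).2.1 (hpre Φ hΦ).2.2
  have h2 := fun i => hcut i (fun j => Φ.symm ⁻¹' P j) (fun y => f ((φ i).symm y) *
      ENNReal.ofReal (Real.sqrt (coordMetric g (c i) y).det)) (hpre _ hΦ').1
      (hpre _ hΦ').2.1 (hpre _ hΦ').2.2
  -- Exchanging the sums pairs the piece `P i ∩ Φ⁻¹(P j)` on the left with its image `P j ∩ Φ(P i)`
  -- on the right.
  rw [tsum_congr h1, tsum_congr h2, ENNReal.tsum_comm]
  refine tsum_congr fun j => tsum_congr fun i => ?_
  let s := φ i '' (P i ∩ Φ ⁻¹' P j)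
  have hs : MeasurableSet s := measurableSet_image_chart (φ i)
    ((hPm i).inter ((hpre Φ hΦ).1 j)) (Set.inter_subset_left.trans (hPs i))
  have hsm : ∀ y ∈ s, y ∈ (φ i).target ∧ Φ ((φ i).symm y) ∈ P j ∧ (φ i).symm y ∈ P i := by
    rintro _ ⟨x, ⟨hx, hx'⟩, rfl⟩
    rw [(φ i).left_inv (hPs i hx)]
    exact ⟨(φ i).map_source (hPs i hx), hx', hx⟩
  have himg : φ j '' (P j ∩ Φ.symm ⁻¹' P i) = inCharts Φ (c i) (c j) '' s := by
    ext z
    constructor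
    · rintro ⟨x, ⟨hx, hx'⟩, rfl⟩
      refine ⟨φ i (Φ.symm x), ⟨Φ.symm x, ⟨hx', ?_⟩, rfl⟩, ?_⟩
      · rw [Set.mem_preimage, Φ.apply_symm_apply]
        exact hx
      · change φ j (Φ ((φ i).symm (φ i (Φ.symm x)))) = φ j x
        rw [(φ i).left_inv (hPs i hx'), Φ.apply_symm_apply]
    · rintro ⟨y, hy, rfl⟩
      refine ⟨Φ ((φ i).symm y), ⟨(hsm y hy).2.1, ?_⟩, rfl⟩
      rw [Set.mem_preimage, Φ.symm_apply_apply]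
      exact (hsm y hy).2.2
  have hinj : Set.InjOn (inCharts Φ (c i) (c j)) s := by
    intro y hy z hz h
    have h3 := (φ j).injOn (hPs j (hsm y hy).2.1) (hPs j (hsm z hz).2.1) h
    exact (φ i).symm.injOn (hsm y hy).1 (hsm z hz).1 (Φ.injective h3)
  rw [himg, MeasureTheory.lintegral_image_eq_lintegral_abs_det_fderiv_mul MeasureTheory.volume hs
    (fun y hy => (differentiableAt_inCharts Φ (hsm y hy).1
      (hPs j (hsm y hy).2.1)).hasFDerivAt.hasFDerivWithinAt) hinj]
  refine MeasureTheory.setLIntegral_congr_fun hs fun y hy => ?_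
  have h3 : (φ j).symm (inCharts Φ (c i) (c j) y) = Φ ((φ i).symm y) :=
    (φ j).left_inv (hPs j (hsm y hy).2.1)
  change _ = ENNReal.ofReal |(fderiv ℝ (inCharts Φ (c i) (c j)) y).det| *
    (f ((φ j).symm (inCharts Φ (c i) (c j) y)) * _)
  rw [h3, coordMetric_pullback Φ g (hsm y hy).1 (hPs j (hsm y hy).2.1),
    Real.sqrt_mul (sq_nonneg _), Real.sqrt_sq_eq_abs, ENNReal.ofReal_mul (abs_nonneg _),
    mul_left_comm]

theorem energy_pullback [T2Space M] [SecondCountableTopology M] [Nonempty M] (hn : 2 ≤ n)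
    {p : ProjectiveStructure n M} (g : Metric n M) {Φ : M ≃ₘ^∞⟮𝓡 n, 𝓡 n⟯ M} (hΦ : Φ ∈ Proj p) :
    energy p (pullbackMetric Φ g) = energy p g := by
  rw [energy, energy, ← volumeIntegral_pullback Φ g]
  congr 1
  ext x
  rw [tensorNorm_map (differential Φ x) (tangentBasis x) (tangentBasis (Φ x)) (g.symm (Φ x))
    (g.pos (Φ x)) (fun _ _ => rfl) (differential_tensorA hn g hΦ x)]

end Manifold
end ProjConf

theorem mainTheorem7 {n : ℕ} (hn : 2 ≤ n) {M : Type*} [TopologicalSpace M] [T2Space M]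
    [SecondCountableTopology M] [ConnectedSpace M] [ChartedSpace (EuclideanSpace ℝ (Fin n)) M]
    [IsManifold (𝓡 n) ∞ M] (p : ProjConf.ProjectiveStructure n M) (g : ProjConf.Metric n M)
    (hattained : ProjConf.energy p g = ProjConf.infEnergy p)
    (hunique : ∀ g' : ProjConf.Metric n M, ProjConf.energy p g' = ProjConf.infEnergy p →
      ProjConf.ConformallyEquivalent g g') :
    ∃ D : ProjConf.Connection n M,
      ProjConf.IsConformalConnection g D ∧
      ProjConf.Represents (D.addOneForm (ProjConf.tensorA p g)) p ∧
      (∀ D' : ProjConf.Connection n M, ProjConf.IsConformalConnection g D' →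
        ProjConf.Represents (D'.addOneForm (ProjConf.tensorA p g)) p →
        ProjConf.SameConnection D' D) ∧
      ProjConf.Proj p = ProjConf.Aff (D.addOneForm (ProjConf.tensorA p g)) ∧
      ProjConf.Aff (D.addOneForm (ProjConf.tensorA p g)) ⊆ ProjConf.Conf g := by
  obtain ⟨D, hD, hDA⟩ := ProjConf.exists_isConformalConnection p g
  -- The pulled-back metric has the same energy, hence is a minimiser, and uniqueness applies. The
  -- resulting conformal equivalence is, after unfolding, membership of `Φ` in `Conf g`.
  have hconf : ∀ Φ ∈ ProjConf.Proj p,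
      ProjConf.ConformallyEquivalent g (ProjConf.pullbackMetric Φ g) := fun Φ hΦ =>
    hunique _ ((ProjConf.energy_pullback hn g hΦ).trans hattained)
  have hsub := ProjConf.aff_subset_proj hDA
  exact ⟨D, hD, hDA, fun D' hD' hDA' => hD.sameConnection hn hD' hDA hDA',
    Set.Subset.antisymm
      (fun Φ hΦ => ProjConf.mem_aff_of_conformal hn hD hDA hΦ (hconf Φ hΦ)) hsub,
    fun Φ hΦ => hconf Φ (hsub hΦ)⟩
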